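/- **Proposition (time decay of the Dirac amplitudes).** Write $\langle x\rangle=(1+|x|^2)^{1/2}$, $D=-i\nabla$ on $\mathbb R^4$, $\|u\|_{H^s}=\|\langle D\rangle^s u\|_{L^2}$ and $\|u\|_{W^{s,\infty}}=\|\langle D\rangle^s u\|_{L^\infty}$. Let $\alpha^1,\dots,\alpha^4,\gamma^0$ be Hermitian $4\times4$ matrices with $\alpha^j\alpha^k+\alpha^k\alpha^j=2\delta^{jk}I_4$, $\alpha^j\gamma^0+\gamma^0\alpha^j=0$ and $(\gamma^0)^2=I_4$, and for $\theta\in\{+,-\}$ put $$\Pi_\theta(D)=\tfrac12\Big(I_4+\theta\,\frac{\alpha\cdot D+\gamma^0}{\langle D\rangle}\Big).$$ For a time-dependent field $\psi(t)$ of $\mathbb C^4$-valued tempered distributions on $\mathbb R^4$ let $\psi_\theta(t)=\Pi_\theta(D)\psi(t)$ and let $f_\theta(t)=e^{\theta it\langle D\rangle}\psi_\theta(t)$ be its profile. For real numbers $n,\delta$ and $T>0$ put $$\|\psi\|_{\Sigma_T}=\sum_{\theta\in\{+,-\}}\ \sup_{t\in[0,T]}\Big[\|\psi_\theta(t)\|_{H^n}+\|x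 f_\theta(t)\|_{L^2}+\langle t\rangle^{-\delta}\|x^2 f_\theta(t)\|_{L^2}\Big].$$ Let $n>2$ and $K>0$ be real. There is a constant $C>0$, depending only on $n$ and $K$, such that the following holds for all real $\beta,\delta$ with $$0<\beta<\delta,\qquad \frac{56}{n-2}\le\beta,\qquad \beta+\delta\le\tfrac14,$$ for all matrices as above, and for all $\varepsilon_1>0$ and $T>0$. If $\|\psi\|_{\Sigma_T}\le K\varepsilon_1$, then for each sign $\theta\in\{+,-\}$, all real $k$ with $0\le k\le 20$ and all $t\in[0,T]$, $$\|\psi_\theta(t)\|_{W^{k,\infty}}\le C\,\langle t\rangle^{-2+\beta+\delta}\,\varepsilon_1 .$$ -/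

import Mathlib

open MeasureTheory TemperedDistribution
open scoped SchwartzMap ENNReal

namespace MaxwellDirac

/-- Physical space `ℝ⁴` with its Euclidean norm. -/
abbrev Space : Type := EuclideanSpace ℝ (Fin 4)

/-- The space `ℂ⁴` of spinors with its Hermitian norm. -/
abbrev Spinor : Type := EuclideanSpace ℂ (Fin 4)

/-- The power `⟨x⟩ ^ s = (1 + |x|²) ^ (s / 2)` of the Japanese bracket. -/
noncomputable def bracketPow {V : Type*} [NormedAddCommGroup V] (s : ℝ) (x : V) : ℝ :=
  (1 + ‖x‖ ^ 2) ^ (s / 2)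

/-- The Fourier multiplier `m(D)`, `D = -i∇`, on tempered distributions with values in `ℂ⁴`.
The Fourier transform of Mathlib has the kernel `exp (-2πi x·ξ)`, so that `D` is multiplication by
`2πξ` on its frequency side. All symbols `m` used below are smooth and, with all their derivatives,
of at most polynomial growth, so that the product with the Fourier transform is the usual one. -/
noncomputable def multiplier (m : Space → ℂ) : 𝓢'(Space, Spinor) →L[ℂ] 𝓢'(Space, Spinor) :=
  fourierMultiplierCLM Spinor (fun ξ => m ((2 * Real.pi) • ξ))

/-- The operator `⟨D⟩ ^ s`. -/
noncomputable def bracketD (s : ℝ) : 𝓢'(Space, Spinor) →L[ℂ] 𝓢'(Space, Spinor) :=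
  multiplier (fun ξ => (bracketPow s ξ : ℂ))

/-- The propagator `exp (i τ ⟨D⟩)`. -/
noncomputable def propagator (τ : ℝ) : 𝓢'(Space, Spinor) →L[ℂ] 𝓢'(Space, Spinor) :=
  multiplier (fun ξ => Complex.exp (Complex.I * ((τ * bracketPow 1 ξ : ℝ) : ℂ)))

/-- A constant matrix acting pointwise on the values of a `ℂ⁴`-valued distribution. -/
noncomputable def matrixAct (M : Matrix (Fin 4) (Fin 4) ℂ) :
    𝓢'(Space, Spinor) →L[ℂ] 𝓢'(Space, Spinor) :=
  PointwiseConvergenceCLM.postcomp 𝓢(Space, ℂ) (Matrix.toEuclideanCLM (n := Fin 4) (𝕜 := ℂ) M)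

/-- The Dirac matrices `α¹, …, α⁴, γ⁰`: Hermitian `4 × 4` matrices with
`(α·ξ + γ⁰)² = (1 + |ξ|²) I` for every `ξ`, that is, satisfying the relations below. -/
structure IsDiracFamily (α : Fin 4 → Matrix (Fin 4) (Fin 4) ℂ)
    (γ₀ : Matrix (Fin 4) (Fin 4) ℂ) : Prop where
  hermitian_α : ∀ j, (α j).IsHermitian
  hermitian_γ₀ : γ₀.IsHermitian
  anticomm_α : ∀ j k, α j * α k + α k * α j = if j = k then 2 else 0
  anticomm_α_γ₀ : ∀ j, α j * γ₀ + γ₀ * α j = 0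
  sq_γ₀ : γ₀ * γ₀ = 1

/-- The projection `Π_θ(D) = ½ (I + θ ⟨D⟩⁻¹ (α·D + γ⁰))`, for a sign `θ = ±1`. -/
noncomputable def diracProj (α : Fin 4 → Matrix (Fin 4) (Fin 4) ℂ) (γ₀ : Matrix (Fin 4) (Fin 4) ℂ)
    (θ : ℤˣ) (u : 𝓢'(Space, Spinor)) : 𝓢'(Space, Spinor) :=
  (1 / 2 : ℂ) • (u + ((θ : ℤ) : ℂ) •
    (∑ j, matrixAct (α j) (multiplier (fun ξ => ((ξ j * bracketPow (-1) ξ : ℝ) : ℂ)) u)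
      + matrixAct γ₀ (bracketD (-1) u)))

/-- The half wave `ψ_θ(t) = Π_θ(D) ψ(t)`. -/
noncomputable def halfWave (α : Fin 4 → Matrix (Fin 4) (Fin 4) ℂ)
    (γ₀ : Matrix (Fin 4) (Fin 4) ℂ) (ψ : ℝ → 𝓢'(Space, Spinor)) (θ : ℤˣ) (t : ℝ) :
    𝓢'(Space, Spinor) :=
  diracProj α γ₀ θ (ψ t)

/-- The profile `f_θ(t) = exp (θ i t ⟨D⟩) ψ_θ(t)`. -/
noncomputable def profile (α : Fin 4 → Matrix (Fin 4) (Fin 4) ℂ)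
    (γ₀ : Matrix (Fin 4) (Fin 4) ℂ) (ψ : ℝ → 𝓢'(Space, Spinor)) (θ : ℤˣ) (t : ℝ) :
    𝓢'(Space, Spinor) :=
  propagator (((θ : ℤ) : ℝ) * t) (halfWave α γ₀ ψ θ t)

/-- `‖u‖_{L^p}` for a tempered distribution: the `L^p` norm of the (unique) `L^p` function
representing `u`, and `∞` if there is none. -/
noncomputable def distLpNorm (p : ℝ≥0∞) [Fact (1 ≤ p)] (u : 𝓢'(Space, Spinor)) : ℝ≥0∞ :=
  ⨅ (g : Lp Spinor p (volume : Measure Space)) (_ : u = (g : 𝓢'(Space, Spinor))),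
    eLpNorm g p volume

/-- `‖ |x|^j u ‖_{L²}` for `u ∈ L²` (possibly `∞`); the value is `∞` if `u` is not in `L²`. -/
noncomputable def weightedL2Norm (j : ℕ) (u : 𝓢'(Space, Spinor)) : ℝ≥0∞ :=
  ⨅ (g : Lp Spinor 2 (volume : Measure Space)) (_ : u = (g : 𝓢'(Space, Spinor))),
    eLpNorm (fun x => ‖x‖ ^ j • g x) 2 volume

/-- `‖u‖_{H^s} = ‖⟨D⟩ ^ s u‖_{L²}`. -/
noncomputable def sobolevNorm (s : ℝ) (u : 𝓢'(Space, Spinor)) : ℝ≥0∞ :=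
  distLpNorm 2 (bracketD s u)

/-- `‖u‖_{W^{s,∞}} = ‖⟨D⟩ ^ s u‖_{L^∞}`. -/
noncomputable def sobolevInftyNorm (s : ℝ) (u : 𝓢'(Space, Spinor)) : ℝ≥0∞ :=
  distLpNorm ∞ (bracketD s u)

/-- The a priori norm of one half wave,
`sup_{t ∈ [0,T]} (‖ψ_θ(t)‖_{H^n} + ‖x f_θ(t)‖_{L²} + ⟨t⟩^{-δ} ‖x² f_θ(t)‖_{L²})`. -/
noncomputable def halfWaveNorm (n δ T : ℝ) (α : Fin 4 → Matrix (Fin 4) (Fin 4) ℂ)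
    (γ₀ : Matrix (Fin 4) (Fin 4) ℂ) (ψ : ℝ → 𝓢'(Space, Spinor)) (θ : ℤˣ) : ℝ≥0∞ :=
  ⨆ t ∈ Set.Icc (0 : ℝ) T,
    (sobolevNorm n (halfWave α γ₀ ψ θ t)
      + weightedL2Norm 1 (profile α γ₀ ψ θ t)
      + ENNReal.ofReal (bracketPow (-δ) t) * weightedL2Norm 2 (profile α γ₀ ψ θ t))

/-- The a priori norm of the spinor field, the sum of the norms of its two half waves. -/
noncomputable def spinorNorm (n δ T : ℝ) (α : Fin 4 → Matrix (Fin 4) (Fin 4) ℂ)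
    (γ₀ : Matrix (Fin 4) (Fin 4) ℂ) (ψ : ℝ → 𝓢'(Space, Spinor)) : ℝ≥0∞ :=
  halfWaveNorm n δ T α γ₀ ψ 1 + halfWaveNorm n δ T α γ₀ ψ (-1)

end MaxwellDirac

/-!
The proof never uses the matrices: a half wave `v = ψ_θ(t)` enters only through `G = ⟨D⟩^n v ∈ L²`
and through its profile `h = exp (iτ⟨D⟩) v`, `τ = θt`, with `|y|² h ∈ L²`. With `l = ⟨2πξ⟩` and
`g = l^(-n) 𝓕 G` the Fourier transform of `v`, one has to bound `∫ e^(2πi x·ξ) l^k g(ξ) dξ`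
uniformly in `x`.

*Dispersion.* In dimension four the Fourier transform of `exp (-z l)`, `Re z > 0`, is elementary.
For real `z` it follows from writing `exp (-z l)` as a mixture of Gaussians, and for complex `z`
from the identity theorem (`fourier_exp_neg_mul_freqBracket`). With `ρ² = z² + |y|²` it is a
combination of `z e^(-ρ) ρ^(-j)`, `j = 3, 4, 5`, and since `Re ρ · Im ρ = Re z · Im z`, for
`z = s + iτ` it is `O(|z| (s|τ|)^(-3))` uniformly in `y`
(`norm_fourier_exp_neg_mul_freqBracket_le`). So the damped half wave `∫ e^(2πi x·ξ) e^(-s l) g dξ`,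
which is the convolution of `h` with this kernel, decays like `τ^(-2)` at the cost of powers of
`1/s`: where `|y| ≤ |τ|` the `L¹` norm of `h` costs a factor `(1 + τ²)^γ` with an arbitrarily small
`γ > 0`, as the weight `|y|²` is critical in dimension four, and where `|y| > |τ|` the weight gains
`τ^(-2)` while the kernel is bounded in `L²` (`norm_integral_exp_smul_freqAmplitude_le`).

*From damped to undamped waves.* For `M > k` the power `l^k` is a multiple of
`∫ (1 - e^(-sl))^M e^(-sl) s^(-k-1) ds` over the half line. The part `s ≥ ε` is a superposition of
damped waves with `s ≥ ε`. On the part `s ≤ ε` the integrand is at most `(sl)^M s^(-k-1)`, and the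
resulting loss of `M` derivatives, `M + 3 ≤ n`, is paid for by the Sobolev norm
(`bumpConst_mul_norm_integral_le`, `bumpConst_mul_norm_le`). With `ε = t^(-β/25)` the hypothesis
`56 / (n - 2) ≤ β` makes the second part `O(t^(-2))` and the losses in the first part at most `t^β`
(`choice_of_threshold`). Times `t ≤ 1` are covered by Sobolev embedding.
-/

namespace MaxwellDirac

open Real Filter Topology Set FourierTransform Function

/-! ### Moments of the Gaussian mixture -/

/-- The fundamental theorem of calculus on the open half line, with limits at both ends and no
condition on the value of `f` at `0`. -/
theorem integral_Ioi_zero_of_hasDerivAt_of_tendsto {f f' : ℝ → ℝ} {l m : ℝ}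
    (hderiv : ∀ r, 0 < r → HasDerivAt f (f' r) r) (hint : IntegrableOn f' (Ioi 0))
    (h0 : Tendsto f (𝓝[>] 0) (𝓝 l)) (hinf : Tendsto f atTop (𝓝 m)) :
    ∫ r in Ioi (0 : ℝ), f' r = m - l := by
  have key := integral_Ioi_of_hasDerivAt_of_tendsto (f := Function.update f 0 l) (f' := f')
    (a := 0) (m := m) ?_ ?_ hint ?_
  · simpa using key
  · rw [← continuousWithinAt_Ioi_iff_Ici, continuousWithinAt_update_same]
    refine h0.mono_left (nhdsWithin_mono _ sdiff_subset)
  · intro x hx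
    have hx' : (0 : ℝ) < x := hx
    refine (hderiv x hx').congr_of_eventuallyEq ?_
    filter_upwards [isOpen_ne.mem_nhds hx'.ne'] with y hy
    exact Function.update_of_ne hy _ _
  · refine hinf.congr' ?_
    filter_upwards [eventually_gt_atTop 0] with y hy
    exact (Function.update_of_ne hy.ne' _ _).symm

/-- The weight `exp (-(a r)² - (b / r)²)` on the half line `r > 0`, through which a Gaussian mixture
represents `exp (-2ab)`. -/
noncomputable def mixWeight (a b r : ℝ) : ℝ := Real.exp (-(a * r) ^ 2 - (b / r) ^ 2)

theorem mixWeight_pos (a b r : ℝ) : 0 < mixWeight a b r := Real.exp_pos _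

/-- The factor `exp (-(b / r)²)` of the weight absorbs negative powers of `r` at the origin. -/
theorem inv_pow_mul_mixWeight_le {b : ℝ} (hb : 0 < b) (a : ℝ) (m : ℕ) {r : ℝ} (hr : 0 < r) :
    (r ^ (2 * m))⁻¹ * mixWeight a b r ≤ m.factorial / b ^ (2 * m) * Real.exp (-(a * r) ^ 2) := by
  have h1 : ((b / r) ^ 2) ^ m / m.factorial ≤ Real.exp ((b / r) ^ 2) :=
    Real.pow_div_factorial_le_exp _ (by positivity) m
  have h2 : (r ^ (2 * m))⁻¹ * Real.exp (-(b / r) ^ 2) ≤ m.factorial / b ^ (2 * m) := by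
    rw [Real.exp_neg, ← mul_inv, inv_le_iff_one_le_mul₀ (by positivity)]
    rw [div_le_iff₀ (by positivity)] at h1
    have h3 : ((b / r) ^ 2) ^ m = b ^ (2 * m) / r ^ (2 * m) := by
      rw [← pow_mul, div_pow]
    rw [h3, div_le_iff₀ (by positivity)] at h1
    rw [mul_comm, ← mul_div_assoc, one_le_div (by positivity)]
    linarith
  calc (r ^ (2 * m))⁻¹ * mixWeight a b r
      = ((r ^ (2 * m))⁻¹ * Real.exp (-(b / r) ^ 2)) * Real.exp (-(a * r) ^ 2) := by
        rw [mixWeight, sub_eq_add_neg, Real.exp_add]; ring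
    _ ≤ _ := by gcongr

theorem integrable_exp_neg_sq_mul {a : ℝ} (ha : 0 < a) :
    Integrable (fun r : ℝ => Real.exp (-(a * r) ^ 2)) := by
  have := integrable_exp_neg_mul_sq (b := a ^ 2) (by positivity)
  refine this.congr (Eventually.of_forall fun r => ?_)
  simp only; congr 1; ring

theorem integrableOn_inv_pow_mul_mixWeight {a b : ℝ} (ha : 0 < a) (hb : 0 < b) (m : ℕ) :
    IntegrableOn (fun r => (r ^ (2 * m))⁻¹ * mixWeight a b r) (Ioi 0) := by
  refine Integrable.mono' (((integrable_exp_neg_sq_mul ha).integrableOn (s := Ioi 0)).const_mul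
    (m.factorial / b ^ (2 * m))) ?_ ?_
  · have : Measurable (fun r => (r ^ (2 * m))⁻¹ * mixWeight a b r) := by
      unfold mixWeight; fun_prop
    exact this.aestronglyMeasurable
  · filter_upwards [ae_restrict_mem measurableSet_Ioi] with r hr
    have hr' : (0 : ℝ) < r := hr
    rw [Real.norm_of_nonneg (mul_nonneg (by positivity) (mixWeight_pos a b r).le)]
    exact inv_pow_mul_mixWeight_le hb a m hr'

theorem hasDerivAt_mixWeight (a b : ℝ) {r : ℝ} (hr : 0 < r) :
    HasDerivAt (mixWeight a b) ((-2 * a ^ 2 * r + 2 * b ^ 2 / r ^ 3) * mixWeight a b r) r := by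
  unfold mixWeight
  have h1 : HasDerivAt (fun r => -(a * r) ^ 2 - (b / r) ^ 2)
      (-2 * a ^ 2 * r + 2 * b ^ 2 / r ^ 3) r := by
    have e1 := (((hasDerivAt_id r).const_mul a).pow 2).neg
    have e2 := (((hasDerivAt_inv hr.ne').const_mul b)).pow 2
    refine ((e1.sub e2).congr_of_eventuallyEq ?_).congr_deriv ?_
    · exact Eventually.of_forall fun x => by simp [div_eq_mul_inv]
    · simp; field_simp
  exact h1.exp.congr_deriv (by ring)

/-- The moments `∫ r^(-2m) exp (-(a r)² - (b / r)²) dr` over the half line. -/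
noncomputable def mixMoment (a b : ℝ) (m : ℕ) : ℝ :=
  ∫ r in Ioi (0 : ℝ), (r ^ (2 * m))⁻¹ * mixWeight a b r

theorem tendsto_exp_neg_mul_sq {a : ℝ} (ha : 0 < a) :
    Tendsto (fun r : ℝ => Real.exp (-(a * r) ^ 2)) atTop (𝓝 0) := by
  refine Real.tendsto_exp_atBot.comp ?_
  refine tendsto_neg_atTop_atBot.comp ?_
  exact (tendsto_pow_atTop (by norm_num)).comp (tendsto_id.const_mul_atTop ha)

theorem mixMoment_recurrence {a b : ℝ} (ha : 0 < a) (hb : 0 < b) (m : ℕ) :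
    2 * b ^ 2 * mixMoment a b (m + 2)
      = (2 * m + 1) * mixMoment a b (m + 1) + 2 * a ^ 2 * mixMoment a b m := by
  have hI := integrableOn_inv_pow_mul_mixWeight ha hb
  have hzero : ∫ r in Ioi (0 : ℝ), (2 * b ^ 2 * ((r ^ (2 * (m + 2)))⁻¹ * mixWeight a b r)
      - (2 * m + 1) * ((r ^ (2 * (m + 1)))⁻¹ * mixWeight a b r)
      - 2 * a ^ 2 * ((r ^ (2 * m))⁻¹ * mixWeight a b r)) = 0 - 0 := by
    have hle : ∀ r : ℝ, 0 < r → r * ((r ^ (2 * (m + 1)))⁻¹ * mixWeight a b r)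
        ≤ (m + 1).factorial / b ^ (2 * (m + 1)) * (r * Real.exp (-(a * r) ^ 2)) := by
      intro r hr
      calc _ ≤ r * ((m + 1).factorial / b ^ (2 * (m + 1)) * Real.exp (-(a * r) ^ 2)) := by
            exact mul_le_mul_of_nonneg_left (inv_pow_mul_mixWeight_le hb a (m + 1) hr) hr.le
        _ = _ := by ring
    refine integral_Ioi_zero_of_hasDerivAt_of_tendsto
      (f := fun r => r * ((r ^ (2 * (m + 1)))⁻¹ * mixWeight a b r)) ?_ ?_ ?_ ?_
    · intro r hr
      have e1 := (hasDerivAt_pow (2 * (m + 1)) r).inv (by positivity)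
      have e2 := (hasDerivAt_id r).mul (e1.mul (hasDerivAt_mixWeight a b hr))
      refine e2.congr_deriv ?_
      have : r ^ (2 * (m + 2)) = r ^ (2 * m) * r ^ 4 := by ring
      have h' : r ^ (2 * (m + 1)) = r ^ (2 * m) * r ^ 2 := by ring
      have h'' : r ^ (2 * (m + 1) - 1) = r ^ (2 * m) * r := by
        rw [show 2 * (m + 1) - 1 = 2 * m + 1 by omega]; ring
      simp only [id, Pi.mul_apply, Pi.inv_apply]
      rw [this, h', h'']
      push_cast
      field_simp
      ring
    · exact (((hI (m + 2)).const_mul _).sub ((hI (m + 1)).const_mul _)).sub ((hI m).const_mul _)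
    · refine squeeze_zero' (g := fun r => (m + 1).factorial / b ^ (2 * (m + 1)) *
        (r * Real.exp (-(a * r) ^ 2))) ?_ ?_ ?_
      · filter_upwards [self_mem_nhdsWithin] with r hr
        have hr' : (0 : ℝ) < r := hr
        have := mixWeight_pos a b r
        positivity
      · filter_upwards [self_mem_nhdsWithin] with r hr using hle r hr
      · have : Continuous fun r => ((m + 1).factorial : ℝ) / b ^ (2 * (m + 1)) *
          (r * Real.exp (-(a * r) ^ 2)) := by fun_prop
        have h := (this.tendsto 0).mono_left (nhdsWithin_le_nhds (s := Ioi 0))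
        simpa using h
    · refine squeeze_zero' (g := fun r => Real.exp (-(a * r) ^ 2)) ?_ ?_
        (tendsto_exp_neg_mul_sq ha)
      · filter_upwards [eventually_gt_atTop 0] with r hr
        have := mixWeight_pos a b r
        positivity
      · filter_upwards [eventually_ge_atTop 1] with r hr
        have hr0 : 0 < r := by linarith
        have e1 : r * ((r ^ (2 * (m + 1)))⁻¹) ≤ 1 := by
          rw [mul_inv_le_iff₀ (by positivity), one_mul]
          exact le_self_pow₀ hr (by omega)
        calc _ = (r * ((r ^ (2 * (m + 1)))⁻¹)) * mixWeight a b r := by ring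
          _ ≤ 1 * mixWeight a b r := by gcongr; exact (mixWeight_pos a b r).le
          _ ≤ _ := by
            rw [one_mul, mixWeight]
            refine Real.exp_le_exp.2 ?_
            have := sq_nonneg (b / r)
            linarith
  rw [integral_sub, integral_sub, integral_const_mul, integral_const_mul,
    integral_const_mul] at hzero
  · change 2 * b ^ 2 * mixMoment a b (m + 2) - (2 * m + 1) * mixMoment a b (m + 1)
      - 2 * a ^ 2 * mixMoment a b m = 0 - 0 at hzero
    linarith
  · exact (hI (m + 2)).const_mul _
  · exact (hI (m + 1)).const_mul _
  · exact ((hI (m + 2)).const_mul _).sub ((hI (m + 1)).const_mul _)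
  · exact (hI m).const_mul _

/-- The primitive of `exp (-v²)` that vanishes at `0`. -/
noncomputable def gaussPrimitive (u : ℝ) : ℝ := ∫ v in (0 : ℝ)..u, Real.exp (-v ^ 2)

theorem hasDerivAt_gaussPrimitive (u : ℝ) :
    HasDerivAt gaussPrimitive (Real.exp (-u ^ 2)) u := by
  have hc : Continuous fun v : ℝ => Real.exp (-v ^ 2) := by fun_prop
  exact intervalIntegral.integral_hasDerivAt_right (hc.intervalIntegrable _ _)
    hc.stronglyMeasurable.stronglyMeasurableAtFilter hc.continuousAt

theorem tendsto_gaussPrimitive_atTop : Tendsto gaussPrimitive atTop (𝓝 (√π / 2)) := by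
  have h1 := integral_gaussian_Ioi 1
  have h2 := (integrable_exp_neg_mul_sq (b := 1) one_pos).integrableOn (s := Ioi 0)
  simp only [neg_mul, one_mul, div_one] at h1 h2
  rw [← h1]
  exact intervalIntegral_tendsto_integral_Ioi 0 h2 tendsto_id

theorem gaussPrimitive_neg (u : ℝ) : gaussPrimitive (-u) = -gaussPrimitive u := by
  unfold gaussPrimitive
  have := intervalIntegral.integral_comp_neg (a := 0) (b := u) fun v : ℝ => Real.exp (-v ^ 2)
  simp only [neg_sq, neg_zero] at this
  rw [this, intervalIntegral.integral_symm]

theorem tendsto_gaussPrimitive_atBot : Tendsto gaussPrimitive atBot (𝓝 (-(√π / 2))) := by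
  have := (tendsto_gaussPrimitive_atTop.comp tendsto_neg_atBot_atTop).neg
  refine this.congr fun u => ?_
  simp [gaussPrimitive_neg]

/-- The derivatives of `E(a r - b / r)` and `E(a r + b / r)`, with `E` the primitive of
`exp (-v²)`, are the combinations `a ± b / r²` of the weight, so that the two lowest moments solve a
linear system of two equations. -/
theorem mixMoment_zero_one {a b : ℝ} (ha : 0 < a) (hb : 0 < b) :
    mixMoment a b 0 = √π / (2 * a) * Real.exp (-(2 * a * b)) ∧
      mixMoment a b 1 = √π / (2 * b) * Real.exp (-(2 * a * b)) := by
  have hI := integrableOn_inv_pow_mul_mixWeight ha hb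
  have hinv0 : Tendsto (fun r : ℝ => b / r) (𝓝[>] 0) atTop := by
    simpa [div_eq_mul_inv] using tendsto_inv_nhdsGT_zero.const_mul_atTop hb
  have hinvT : Tendsto (fun r : ℝ => b / r) atTop (𝓝 0) := tendsto_const_nhds.div_atTop tendsto_id
  have hlin0 : Tendsto (fun r : ℝ => a * r) (𝓝[>] 0) (𝓝 0) := by
    have : Continuous fun r : ℝ => a * r := by fun_prop
    simpa using (this.tendsto 0).mono_left (nhdsWithin_le_nhds (s := Ioi 0))
  have hlinT : Tendsto (fun r : ℝ => a * r) atTop atTop := tendsto_id.const_mul_atTop ha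
  have key : ∀ σ : ℝ, σ ^ 2 = 1 → ∀ l : ℝ,
      Tendsto (fun r => gaussPrimitive (a * r + σ * (b / r))) (𝓝[>] 0) (𝓝 l) →
      a * mixMoment a b 0 - σ * b * mixMoment a b 1
        = Real.exp (σ * (2 * a * b)) * (√π / 2 - l) := by
    intro σ hσ l hl
    have h : ∫ r in Ioi (0 : ℝ), (a * ((r ^ (2 * 0))⁻¹ * mixWeight a b r)
        - σ * b * ((r ^ (2 * 1))⁻¹ * mixWeight a b r))
        = Real.exp (σ * (2 * a * b)) * (√π / 2) - Real.exp (σ * (2 * a * b)) * l := by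
      refine integral_Ioi_zero_of_hasDerivAt_of_tendsto
        (f := fun r => Real.exp (σ * (2 * a * b)) * gaussPrimitive (a * r + σ * (b / r)))
        ?_ (((hI 0).const_mul _).sub ((hI 1).const_mul _)) (hl.const_mul _) ?_
      · intro r hr
        have e1 : HasDerivAt (fun r => a * r + σ * (b / r)) (a - σ * (b / r ^ 2)) r := by
          have := ((hasDerivAt_id r).const_mul a).add
            (((hasDerivAt_inv hr.ne').const_mul b).const_mul σ)
          refine (this.congr_of_eventuallyEq ?_).congr_deriv ?_
          · exact Eventually.of_forall fun x => by simp [div_eq_mul_inv]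
          · simp; field_simp; ring
        have e2 := ((hasDerivAt_gaussPrimitive (a * r + σ * (b / r))).comp r e1).const_mul
          (Real.exp (σ * (2 * a * b)))
        refine e2.congr_deriv ?_
        have e3 : Real.exp (σ * (2 * a * b)) * Real.exp (-(a * r + σ * (b / r)) ^ 2)
            = mixWeight a b r := by
          rw [← Real.exp_add, mixWeight]
          congr 1
          have : a * r * (b / r) = a * b := by field_simp
          linear_combination (-2 * σ) * this - (b / r) ^ 2 * hσ
        rw [← mul_assoc, e3]
        simp
        field_simp
      · refine Tendsto.const_mul _ (tendsto_gaussPrimitive_atTop.comp ?_)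
        exact hlinT.atTop_add (hinvT.const_mul σ)
    rw [integral_sub ((hI 0).const_mul _) ((hI 1).const_mul _), integral_const_mul,
      integral_const_mul] at h
    change a * mixMoment a b 0 - σ * b * mixMoment a b 1 = _ at h
    rw [h]; ring
  have k1 := key 1 (by norm_num) (√π / 2) (by
    refine tendsto_gaussPrimitive_atTop.comp ?_
    simpa using hlin0.add_atTop hinv0)
  have k2 := key (-1) (by norm_num) (-(√π / 2)) (by
    refine tendsto_gaussPrimitive_atBot.comp ?_
    refine hlin0.add_atBot ?_
    exact (tendsto_neg_atTop_atBot.comp hinv0).congr fun r => by simp)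
  rw [sub_self, mul_zero] at k1
  have e4 : Real.exp (-1 * (2 * a * b)) = Real.exp (-(2 * a * b)) := by congr 1; ring
  rw [e4] at k2
  constructor
  · rw [div_mul_eq_mul_div, eq_div_iff (by positivity)]
    linear_combination k1 + k2
  · rw [div_mul_eq_mul_div, eq_div_iff (by positivity)]
    linear_combination k2 - k1

/-! ### The symbol of the Japanese bracket and its damped exponentials -/

/-- The symbol `⟨2πξ⟩` of `⟨D⟩` in the frequency variable of Mathlib's Fourier transform. -/
noncomputable def freqBracket (ξ : Space) : ℝ := bracketPow 1 ((2 * π) • ξ)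

theorem freqBracket_eq (ξ : Space) : freqBracket ξ = (1 + ‖(2 * π) • ξ‖ ^ 2) ^ (1 / 2 : ℝ) := rfl

theorem freqBracket_sq (ξ : Space) : freqBracket ξ ^ 2 = 1 + 4 * π ^ 2 * ‖ξ‖ ^ 2 := by
  rw [freqBracket_eq, ← Real.sqrt_eq_rpow, Real.sq_sqrt (by positivity), norm_smul,
    Real.norm_of_nonneg (by positivity)]
  ring

theorem freqBracket_pos (ξ : Space) : 0 < freqBracket ξ := by
  rw [freqBracket_eq]; positivity

theorem one_le_freqBracket (ξ : Space) : 1 ≤ freqBracket ξ :=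
  Real.one_le_rpow (by nlinarith [sq_nonneg ‖(2 * π) • ξ‖]) (by norm_num)

theorem bracketPow_two_pi_smul (s : ℝ) (ξ : Space) :
    bracketPow s ((2 * π) • ξ) = freqBracket ξ ^ s := by
  rw [freqBracket_eq, ← Real.rpow_mul (by positivity), bracketPow]
  congr 1; ring

theorem continuous_freqBracket : Continuous freqBracket := by
  have : freqBracket = fun ξ => (1 + ‖(2 * π) • ξ‖ ^ 2) ^ (1 / 2 : ℝ) := by
    ext; exact freqBracket_eq _
  rw [this]
  refine Continuous.rpow_const (by fun_prop) fun ξ => Or.inr (by norm_num)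

theorem integrable_freqBracket_rpow_neg {r : ℝ} (hr : 4 < r) :
    Integrable fun ξ : Space => freqBracket ξ ^ (-r) := by
  have h := integrable_rpow_neg_one_add_norm_sq (E := Space) (μ := volume) (r := r)
      (by simpa using hr)
  have h2 := h.comp_smul (R := 2 * π) (by positivity)
  refine h2.congr (Eventually.of_forall fun ξ => ?_)
  simp only
  rw [freqBracket_eq, ← Real.rpow_mul (by positivity)]
  congr 1; ring

theorem exp_neg_le_factorial_mul_rpow {x : ℝ} (hx : 0 < x) (m : ℕ) :
    Real.exp (-x) ≤ m.factorial * x ^ (-(m : ℝ)) := by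
  have h1 := Real.pow_div_factorial_le_exp x hx.le m
  rw [Real.rpow_neg hx.le, Real.rpow_natCast, Real.exp_neg,
    inv_le_comm₀ (Real.exp_pos x) (by positivity), mul_inv, inv_inv]
  rwa [div_eq_inv_mul] at h1

theorem integrable_freqBracket_pow_mul_exp {s : ℝ} (hs : 0 < s) (j : ℕ) :
    Integrable fun ξ : Space => freqBracket ξ ^ j * Real.exp (-(s * freqBracket ξ)) := by
  refine Integrable.mono' ((integrable_freqBracket_rpow_neg (r := 5) (by norm_num)).const_mul
    ((j + 5).factorial * s ^ (-((j + 5 : ℕ) : ℝ)))) ?_ (Eventually.of_forall fun ξ => ?_)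
  · have := continuous_freqBracket
    exact Continuous.aestronglyMeasurable (by fun_prop)
  · have hl := freqBracket_pos ξ
    rw [Real.norm_of_nonneg (by positivity)]
    calc _ ≤ freqBracket ξ ^ j *
          ((j + 5).factorial * (s * freqBracket ξ) ^ (-((j + 5 : ℕ) : ℝ))) := by
          gcongr; exact exp_neg_le_factorial_mul_rpow (by positivity) (j + 5)
      _ = _ := by
        rw [Real.mul_rpow hs.le hl.le, ← Real.rpow_natCast (freqBracket ξ) j]
        have : freqBracket ξ ^ (-5 : ℝ)
            = freqBracket ξ ^ (j : ℝ) * freqBracket ξ ^ (-((j + 5 : ℕ) : ℝ)) := by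
          rw [← Real.rpow_add hl]; congr 1; push_cast; ring
        rw [this]; ring

theorem norm_cexp_neg_mul_freqBracket (z : ℂ) (ξ : Space) :
    ‖Complex.exp (-(z * freqBracket ξ))‖ = Real.exp (-(z.re * freqBracket ξ)) := by
  rw [Complex.norm_exp]; simp

theorem integrable_cexp_neg_mul_freqBracket {z : ℂ} (hz : 0 < z.re) :
    Integrable fun ξ : Space => Complex.exp (-(z * freqBracket ξ)) := by
  have := integrable_freqBracket_pow_mul_exp hz 0
  refine this.mono ?_ (Eventually.of_forall fun ξ => ?_)
  · have := continuous_freqBracket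
    exact Continuous.aestronglyMeasurable (by fun_prop)
  · rw [norm_cexp_neg_mul_freqBracket]
    simp

/-! ### The kernel for a real parameter -/

theorem mixMoment_one_three {ρ : ℝ} (hρ : 0 < ρ) :
    mixMoment 1 (ρ / 2) 3
      = 4 * √π * Real.exp (-ρ) * (1 / ρ ^ 3 + 3 / ρ ^ 4 + 3 / ρ ^ 5) := by
  obtain ⟨h0, h1⟩ := mixMoment_zero_one one_pos (half_pos hρ)
  have h2 := mixMoment_recurrence one_pos (half_pos hρ) 0
  have h3 := mixMoment_recurrence one_pos (half_pos hρ) 1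
  have e : 2 * 1 * (ρ / 2) = ρ := by ring
  rw [e] at h0 h1
  norm_num at h2 h3
  have h2' : mixMoment 1 (ρ / 2) 2
      = 2 / ρ ^ 2 * (mixMoment 1 (ρ / 2) 1 + 2 * mixMoment 1 (ρ / 2) 0) := by
    field_simp; linear_combination 2 * h2
  have h3' : mixMoment 1 (ρ / 2) 3
      = 2 / ρ ^ 2 * (3 * mixMoment 1 (ρ / 2) 2 + 2 * mixMoment 1 (ρ / 2) 1) := by
    field_simp; linear_combination 2 * h3
  rw [h3', h2', h1, h0]
  field_simp
  ring

theorem mixWeight_freqBracket (b r : ℝ) (ξ : Space) :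
    mixWeight (freqBracket ξ) b r
      = mixWeight 1 b r * Real.exp (-(4 * π ^ 2 * r ^ 2) * ‖ξ‖ ^ 2) := by
  rw [mixWeight, mixWeight, ← Real.exp_add]
  congr 1
  rw [mul_pow, freqBracket_sq]
  ring

theorem integral_exp_neg_mul_norm_sq_space {r : ℝ} (hr : 0 < r) :
    ∫ ξ : Space, Real.exp (-(4 * π ^ 2 * r ^ 2) * ‖ξ‖ ^ 2) = (16 * π ^ 2)⁻¹ * (r ^ 4)⁻¹ := by
  rw [GaussianFourier.integral_rexp_neg_mul_sq_norm (by positivity)]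
  rw [show ((Module.finrank ℝ Space : ℝ) / 2) = (2 : ℕ) by simp; norm_num, Real.rpow_natCast]
  field_simp
  ring

theorem fourier_gaussian_space {r : ℝ} (hr : 0 < r) (y : Space) :
    𝓕 (fun ξ : Space => ((Real.exp (-(4 * π ^ 2 * r ^ 2) * ‖ξ‖ ^ 2) : ℝ) : ℂ)) y
      = (((16 * π ^ 2)⁻¹ * (r ^ 4)⁻¹ * Real.exp (-(‖y‖ / 2 / r) ^ 2) : ℝ) : ℂ) := by
  have h := fourier_gaussian_innerProductSpace (V := Space) (b := ((4 * π ^ 2 * r ^ 2 : ℝ) : ℂ))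
    (by rw [Complex.ofReal_re]; positivity) y
  have e : (fun ξ : Space => ((Real.exp (-(4 * π ^ 2 * r ^ 2) * ‖ξ‖ ^ 2) : ℝ) : ℂ))
      = fun ξ : Space => Complex.exp (-((4 * π ^ 2 * r ^ 2 : ℝ) : ℂ) * (‖ξ‖ : ℂ) ^ 2) := by
    ext ξ; push_cast; rfl
  rw [e, h, show ((Module.finrank ℝ Space : ℂ) / 2) = (2 : ℕ) by simp; norm_num,
    Complex.cpow_natCast]
  have hπ : (π : ℂ) ≠ 0 := by exact_mod_cast Real.pi_ne_zero
  have hr' : (r : ℂ) ≠ 0 := by exact_mod_cast hr.ne'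
  push_cast
  congr 1
  · field_simp
    ring
  · congr 1
    field_simp
    ring

/-- The value at `y` of the Fourier transform of `exp (-z⟨2πξ⟩)`, in terms of a square root `ρ` of
`z² + |y|²`: a Bessel function of half-integer order, hence elementary, as the dimension is even. -/
noncomputable def poissonKernel (z ρ : ℂ) : ℂ :=
  z * Complex.exp (-ρ) * (1 / ρ ^ 3 + 3 / ρ ^ 4 + 3 / ρ ^ 5) / (4 * π ^ 2)

theorem fourier_exp_neg_mul_freqBracket_of_real {z : ℝ} (hz : 0 < z) (y : Space) :
    𝓕 (fun ξ : Space => Complex.exp (-((z : ℂ) * freqBracket ξ))) y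
      = poissonKernel z (√(z ^ 2 + ‖y‖ ^ 2) : ℝ) := by
  set ρ := √(z ^ 2 + ‖y‖ ^ 2) with hρ
  have hρpos : 0 < ρ := Real.sqrt_pos.2 (by positivity)
  have hρsq : ρ ^ 2 = z ^ 2 + ‖y‖ ^ 2 := Real.sq_sqrt (by positivity)
  let gs : ℝ → Space → ℝ := fun r ξ => Real.exp (-(4 * π ^ 2 * r ^ 2) * ‖ξ‖ ^ 2)
  let w : ℝ → ℝ := fun r => (r ^ (2 * 1))⁻¹ * mixWeight 1 (z / 2) r
  -- the subordination formula for `exp (-z⟨2πξ⟩)`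
  have hsub : ∀ ξ : Space, Real.exp (-(z * freqBracket ξ))
      = z / √π * ∫ r in Ioi (0 : ℝ), w r * gs r ξ := by
    intro ξ
    have h := (mixMoment_zero_one (freqBracket_pos ξ) (half_pos hz)).2
    have e : ∫ r in Ioi (0 : ℝ), w r * gs r ξ = mixMoment (freqBracket ξ) (z / 2) 1 := by
      refine integral_congr_ae (Eventually.of_forall fun r => ?_)
      simp only [w, gs, mixWeight_freqBracket]; ring
    rw [e, h]
    have : √π ≠ 0 := (Real.sqrt_pos.2 Real.pi_pos).ne'
    rw [show 2 * freqBracket ξ * (z / 2) = z * freqBracket ξ by ring]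
    field_simp
  have hwpos : ∀ r, 0 ≤ w r := fun r => mul_nonneg (by simp; positivity) (mixWeight_pos _ _ _).le
  have hgsI : ∀ r : ℝ, 0 < r → Integrable (gs r) := fun r hr => by
    have h0 : ∫ ξ : Space, Real.exp (-(4 * π ^ 2 * r ^ 2) * ‖ξ‖ ^ 2) ≠ 0 := by
      rw [integral_exp_neg_mul_norm_sq_space hr]; positivity
    exact Integrable.of_integral_ne_zero h0
  let F : Space → ℝ → ℂ := fun ξ r => (𝐞 (-inner ℝ ξ y) : ℂ) * ((w r * gs r ξ : ℝ) : ℂ)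
  have hnorm : ∀ ξ r, ‖F ξ r‖ = w r * gs r ξ := fun ξ r => by
    have : 0 ≤ w r * gs r ξ := mul_nonneg (hwpos r) (Real.exp_pos _).le
    simp only [F]
    rw [norm_mul, Circle.norm_coe, one_mul, Complex.norm_real, Real.norm_of_nonneg this]
  have hmeas : Measurable (Function.uncurry F) := by
    have h1 : Measurable fun p : Space × ℝ => w p.2 * gs p.2 p.1 := by
      simp only [w, gs, mixWeight]; fun_prop
    have h2 : Measurable fun p : Space × ℝ => (𝐞 (-inner ℝ p.1 y) : ℂ) := by
      refine Continuous.measurable ?_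
      exact continuous_subtype_val.comp (continuous_fourierChar.comp (by fun_prop))
    exact h2.mul (Complex.measurable_ofReal.comp h1)
  have hint : Integrable (Function.uncurry F) (volume.prod (volume.restrict (Ioi (0 : ℝ)))) := by
    rw [integrable_prod_iff' hmeas.aestronglyMeasurable]
    constructor
    · filter_upwards [ae_restrict_mem measurableSet_Ioi] with r hr
      have hI : Integrable (fun ξ => w r * gs r ξ) := (hgsI r hr).const_mul _
      refine hI.mono' ?_ (Eventually.of_forall fun ξ => (hnorm ξ r).le)
      exact (hmeas.comp (by fun_prop : Measurable fun ξ : Space => (ξ, r))).aestronglyMeasurable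
    · have := (integrableOn_inv_pow_mul_mixWeight one_pos (half_pos hz) 3).const_mul (16 * π ^ 2)⁻¹
      refine Integrable.congr this ?_
      filter_upwards [ae_restrict_mem measurableSet_Ioi] with r hr
      have hr' : (0 : ℝ) < r := hr
      simp only [Function.uncurry, hnorm]
      rw [integral_const_mul, integral_exp_neg_mul_norm_sq_space hr']
      simp only [w]
      field_simp
      ring
  have hswap := integral_integral_swap hint
  have hleft : 𝓕 (fun ξ : Space => Complex.exp (-((z : ℂ) * freqBracket ξ))) y
      = ((z / √π : ℝ) : ℂ) * ∫ ξ, ∫ r in Ioi (0 : ℝ), F ξ r := by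
    rw [Real.fourier_eq, ← integral_const_mul]
    refine integral_congr_ae (Eventually.of_forall fun ξ => ?_)
    simp only [F]
    rw [integral_const_mul, integral_complex_ofReal, Circle.smul_def, smul_eq_mul]
    have := hsub ξ
    have h' : Complex.exp (-((z : ℂ) * freqBracket ξ))
        = ((z / √π * ∫ r in Ioi (0 : ℝ), w r * gs r ξ : ℝ) : ℂ) := by
      rw [← this]; push_cast; rfl
    rw [h']; push_cast; ring
  have hright : ∫ r in Ioi (0 : ℝ), ∫ ξ, F ξ r
      = (((16 * π ^ 2)⁻¹ * mixMoment 1 (ρ / 2) 3 : ℝ) : ℂ) := by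
    rw [mixMoment, ← integral_const_mul, ← integral_complex_ofReal]
    refine setIntegral_congr_fun measurableSet_Ioi fun r hr => ?_
    have hr' : (0 : ℝ) < r := hr
    have h := fourier_gaussian_space hr' y
    rw [Real.fourier_eq] at h
    have e : ∫ ξ, F ξ r = (w r : ℂ) * ∫ ξ : Space, 𝐞 (-inner ℝ ξ y) •
        ((Real.exp (-(4 * π ^ 2 * r ^ 2) * ‖ξ‖ ^ 2) : ℝ) : ℂ) := by
      rw [← integral_const_mul]
      refine integral_congr_ae (Eventually.of_forall fun ξ => ?_)
      simp only [F, gs]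
      rw [Circle.smul_def, smul_eq_mul]; push_cast; ring
    rw [e, h, ← Complex.ofReal_mul]
    congr 1
    have e2 : mixWeight 1 (z / 2) r * Real.exp (-(‖y‖ / 2 / r) ^ 2) = mixWeight 1 (ρ / 2) r := by
      rw [mixWeight, mixWeight, ← Real.exp_add]
      congr 1
      field_simp
      rw [hρsq]; ring
    rw [← e2]
    simp only [w]
    field_simp
    ring
  rw [hleft, hswap, hright, mixMoment_one_three hρpos, poissonKernel]
  have hs : (√π : ℝ) ≠ 0 := (Real.sqrt_pos.2 Real.pi_pos).ne'
  have e3 : z / √π * ((16 * π ^ 2)⁻¹ * (4 * √π * Real.exp (-ρ) *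
      (1 / ρ ^ 3 + 3 / ρ ^ 4 + 3 / ρ ^ 5)))
      = z * Real.exp (-ρ) * (1 / ρ ^ 3 + 3 / ρ ^ 4 + 3 / ρ ^ 5) / (4 * π ^ 2) := by
    field_simp; ring
  rw [← Complex.ofReal_mul, e3]
  push_cast; rfl

/-! ### The damped propagation kernel for complex parameters -/

/-- The principal square root of `z² + |y|²`. -/
noncomputable def kernelRoot (y : Space) (z : ℂ) : ℂ := (z ^ 2 + (‖y‖ : ℂ) ^ 2) ^ (1 / 2 : ℂ)

theorem sq_add_norm_sq_mem_slitPlane (y : Space) {z : ℂ} (hz : 0 < z.re) :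
    z ^ 2 + (‖y‖ : ℂ) ^ 2 ∈ Complex.slitPlane := by
  rw [Complex.mem_slitPlane_iff]
  rcases eq_or_ne z.im 0 with h | h
  · left
    have : (z ^ 2 + (‖y‖ : ℂ) ^ 2).re = z.re ^ 2 + ‖y‖ ^ 2 := by
      simp [pow_two, h]
    rw [this]; positivity
  · right
    have : (z ^ 2 + (‖y‖ : ℂ) ^ 2).im = 2 * (z.re * z.im) := by
      simp [pow_two]; ring
    rw [this]
    positivity

theorem kernelRoot_sq (y : Space) (z : ℂ) : kernelRoot y z ^ 2 = z ^ 2 + (‖y‖ : ℂ) ^ 2 := by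
  rw [kernelRoot, ← Complex.cpow_mul_nat]; simp

theorem kernelRoot_re_pos (y : Space) {z : ℂ} (hz : 0 < z.re) : 0 < (kernelRoot y z).re := by
  have hw := sq_add_norm_sq_mem_slitPlane y hz
  set w := z ^ 2 + (‖y‖ : ℂ) ^ 2
  have h0 : w ≠ 0 := Complex.slitPlane_ne_zero hw
  have harg := Complex.mem_slitPlane_iff_arg.1 hw
  have h1 := Complex.neg_pi_lt_arg w
  have h2 := Complex.arg_le_pi w
  have h3 : w.arg < π := lt_of_le_of_ne h2 harg.1
  rw [kernelRoot, Complex.cpow_def_of_ne_zero h0, Complex.exp_re]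
  have him : (Complex.log w * (1 / 2)).im = w.arg / 2 := by
    rw [show (1 / 2 : ℂ) = ((1 / 2 : ℝ) : ℂ) by norm_num, Complex.im_mul_ofReal, Complex.log_im]
    ring
  rw [him]
  exact mul_pos (Real.exp_pos _) (Real.cos_pos_of_mem_Ioo ⟨by linarith, by linarith⟩)

theorem kernelRoot_ne_zero (y : Space) {z : ℂ} (hz : 0 < z.re) : kernelRoot y z ≠ 0 := by
  intro h
  have := kernelRoot_re_pos y hz
  simp [h] at this

theorem kernelRoot_ofReal (y : Space) {z : ℝ} (hz : 0 < z) :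
    kernelRoot y z = (√(z ^ 2 + ‖y‖ ^ 2) : ℝ) := by
  rw [kernelRoot, Real.sqrt_eq_rpow, Complex.ofReal_cpow (by positivity)]
  push_cast; rfl

theorem isOpen_re_pos : IsOpen {z : ℂ | 0 < z.re} :=
  isOpen_lt continuous_const Complex.continuous_re

theorem differentiableOn_poissonKernel (y : Space) :
    DifferentiableOn ℂ (fun z => poissonKernel z (kernelRoot y z)) {z | 0 < z.re} := by
  intro z hz
  have h0 := kernelRoot_ne_zero y hz
  have h1 : DifferentiableAt ℂ (kernelRoot y) z := by
    unfold kernelRoot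
    exact (by fun_prop : DifferentiableAt ℂ (fun z : ℂ => z ^ 2 + (‖y‖ : ℂ) ^ 2) z).cpow_const
      (sq_add_norm_sq_mem_slitPlane y hz)
  have h2 : DifferentiableAt ℂ (fun z => poissonKernel z (kernelRoot y z)) z := by
    unfold poissonKernel
    have e3 := (differentiableAt_const (1 : ℂ)).div (h1.pow 3) (pow_ne_zero 3 h0)
    have e4 := (differentiableAt_const (3 : ℂ)).div (h1.pow 4) (pow_ne_zero 4 h0)
    have e5 := (differentiableAt_const (3 : ℂ)).div (h1.pow 5) (pow_ne_zero 5 h0)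
    exact ((differentiableAt_id.mul h1.neg.cexp).mul ((e3.add e4).add e5)).div_const _
  exact h2.differentiableWithinAt

theorem differentiableOn_fourier_exp_neg_mul_freqBracket (y : Space) :
    DifferentiableOn ℂ
      (fun z : ℂ => 𝓕 (fun ξ : Space => Complex.exp (-(z * freqBracket ξ))) y) {z | 0 < z.re} := by
  intro z₀ hz₀
  have hz₀' : 0 < z₀.re := hz₀
  have hc := continuous_freqBracket
  have hch : Continuous fun ξ : Space => (𝐞 (-inner ℝ ξ y) : ℂ) :=
    continuous_subtype_val.comp (continuous_fourierChar.comp (by fun_prop))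
  have key := hasDerivAt_integral_of_dominated_loc_of_deriv_le (μ := (volume : Measure Space))
    (s := {z : ℂ | z₀.re / 2 < z.re}) (x₀ := z₀)
    (F := fun z ξ => (𝐞 (-inner ℝ ξ y) : ℂ) * Complex.exp (-(z * freqBracket ξ)))
    (F' := fun z ξ => (𝐞 (-inner ℝ ξ y) : ℂ) *
      (Complex.exp (-(z * freqBracket ξ)) * (-(1 * freqBracket ξ))))
    (bound := fun ξ => freqBracket ξ ^ 1 * Real.exp (-(z₀.re / 2 * freqBracket ξ)))
    ((isOpen_lt continuous_const Complex.continuous_re).mem_nhds (by simp; linarith))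
    (Eventually.of_forall fun z => Continuous.aestronglyMeasurable (by fun_prop))
    ?_ (Continuous.aestronglyMeasurable (by fun_prop)) ?_
    (integrable_freqBracket_pow_mul_exp (half_pos hz₀') 1) ?_
  · refine key.2.differentiableAt.differentiableWithinAt.congr ?_ ?_
    · intro z _
      rw [Real.fourier_eq]; rfl
    · rw [Real.fourier_eq]; rfl
  · refine (integrable_cexp_neg_mul_freqBracket hz₀').mono
      (Continuous.aestronglyMeasurable (by fun_prop)) (Eventually.of_forall fun ξ => ?_)
    rw [norm_mul, Circle.norm_coe, one_mul]
  · refine Eventually.of_forall fun ξ z hz => ?_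
    have hl := freqBracket_pos ξ
    have hz' : z₀.re / 2 < z.re := hz
    rw [norm_mul, Circle.norm_coe, one_mul, norm_mul, norm_cexp_neg_mul_freqBracket,
      one_mul, norm_neg,
      Complex.norm_real, Real.norm_of_nonneg hl.le, mul_comm, pow_one]
    gcongr
  · refine Eventually.of_forall fun ξ z _ => ?_
    exact ((((hasDerivAt_id z).mul_const (freqBracket ξ : ℂ)).neg).cexp).const_mul _

/-- Both sides are holomorphic in `z` and agree on the positive real axis. -/
theorem fourier_exp_neg_mul_freqBracket {z : ℂ} (hz : 0 < z.re) (y : Space) :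
    𝓕 (fun ξ : Space => Complex.exp (-(z * freqBracket ξ))) y
      = poissonKernel z (kernelRoot y z) := by
  have hU := isOpen_re_pos
  have hconn : IsPreconnected {z : ℂ | 0 < z.re} := (convex_halfSpace_re_gt 0).isPreconnected
  refine AnalyticOnNhd.eqOn_of_preconnected_of_frequently_eq
    ((differentiableOn_fourier_exp_neg_mul_freqBracket y).analyticOnNhd hU)
    ((differentiableOn_poissonKernel y).analyticOnNhd hU) hconn (z₀ := 1) (by simp) ?_ hz
  have htend : Tendsto (fun n : ℕ => ((1 + 1 / ((n : ℝ) + 1) : ℝ) : ℂ)) atTop (𝓝[≠] 1) := by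
    refine tendsto_nhdsWithin_of_tendsto_nhds_of_eventually_within _ ?_ ?_
    · have h := (tendsto_const_nhds (x := (1 : ℝ))).add tendsto_one_div_add_atTop_nhds_zero_nat
      rw [add_zero] at h
      have := (Complex.continuous_ofReal.tendsto 1).comp h
      rwa [Complex.ofReal_one] at this
    · refine Eventually.of_forall fun n => ?_
      have h : (1 + 1 / ((n : ℝ) + 1) : ℝ) ≠ 1 := by
        have : 0 < 1 / ((n : ℝ) + 1) := by positivity
        linarith
      simpa only [mem_compl_iff, mem_singleton_iff, ← Complex.ofReal_one, Complex.ofReal_inj]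
        using h
  refine htend.frequently (Frequently.of_forall fun n => ?_)
  have hpos : 0 < (1 + 1 / ((n : ℝ) + 1) : ℝ) := by positivity
  rw [kernelRoot_ofReal y hpos]
  exact fourier_exp_neg_mul_freqBracket_of_real hpos y

theorem inv_pow_mul_exp_neg_le {a R p : ℝ} (hR : 0 < R) (hp : 0 < p) (h : p ≤ R * a)
    (m : ℕ) : (R ^ m)⁻¹ * Real.exp (-a) ≤ m.factorial * (p ^ m)⁻¹ := by
  have ha : 0 < a := by
    by_contra! hcon
    nlinarith
  calc (R ^ m)⁻¹ * Real.exp (-a) ≤ (R ^ m)⁻¹ * (m.factorial * a ^ (-(m : ℝ))) := by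
        gcongr; exact exp_neg_le_factorial_mul_rpow ha m
    _ = m.factorial * ((R * a) ^ m)⁻¹ := by
        rw [Real.rpow_neg ha.le, Real.rpow_natCast, mul_pow, mul_inv]; ring
    _ ≤ _ := by gcongr

/-- The dispersive estimate for the half Klein-Gordon flow in dimension four. As
`Re ρ · Im ρ = Re z · Im z`, the damping factor `exp (-Re ρ)` compensates for the vanishing of
`|ρ|` near the light cone. -/
theorem norm_fourier_exp_neg_mul_freqBracket_le {z : ℂ} (hz : 0 < z.re) (hp : 1 ≤ z.re * |z.im|)
    (y : Space) :
    ‖𝓕 (fun ξ : Space => Complex.exp (-(z * freqBracket ξ))) y‖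
      ≤ 438 * (‖z‖ * ((z.re * |z.im|) ^ 3)⁻¹) := by
  rw [fourier_exp_neg_mul_freqBracket hz y]
  set p := z.re * |z.im| with hpdef
  set ρ := kernelRoot y z with hρ
  have hre : 0 < ρ.re := kernelRoot_re_pos y hz
  have hρ0 : ρ ≠ 0 := kernelRoot_ne_zero y hz
  have hR : 0 < ‖ρ‖ := norm_pos_iff.2 hρ0
  have him : ρ.re * ρ.im = z.re * z.im := by
    have := congrArg Complex.im (kernelRoot_sq y z)
    rw [← hρ] at this
    simp [pow_two] at this
    linarith
  have hpR : p ≤ ‖ρ‖ * ρ.re := by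
    have h1 : p = ρ.re * |ρ.im| := by
      rw [hpdef, ← abs_of_pos hz, ← abs_mul, ← him, abs_mul, abs_of_pos hre]
    rw [h1, mul_comm]
    exact mul_le_mul_of_nonneg_right (Complex.abs_im_le_norm ρ) hre.le
  have hp0 : 0 < p := by linarith
  have b3 := inv_pow_mul_exp_neg_le hR hp0 hpR 3
  have b4 := inv_pow_mul_exp_neg_le hR hp0 hpR 4
  have b5 := inv_pow_mul_exp_neg_le hR hp0 hpR 5
  have i4 : (p ^ 4)⁻¹ ≤ (p ^ 3)⁻¹ := by gcongr; norm_num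
  have i5 : (p ^ 5)⁻¹ ≤ (p ^ 3)⁻¹ := by gcongr; norm_num
  have hexp : ‖Complex.exp (-ρ)‖ = Real.exp (-ρ.re) := by rw [Complex.norm_exp]; simp
  have hsum : ‖1 / ρ ^ 3 + 3 / ρ ^ 4 + 3 / ρ ^ 5‖
      ≤ (‖ρ‖ ^ 3)⁻¹ + 3 * (‖ρ‖ ^ 4)⁻¹ + 3 * (‖ρ‖ ^ 5)⁻¹ := by
    refine (norm_add₃_le).trans (le_of_eq ?_)
    simp [div_eq_mul_inv]
  have hpi : 1 ≤ ‖(4 * π ^ 2 : ℂ)‖ := by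
    have : (4 * π ^ 2 : ℂ) = ((4 * π ^ 2 : ℝ) : ℂ) := by push_cast; rfl
    rw [this, Complex.norm_real, Real.norm_of_nonneg (by positivity)]
    nlinarith [Real.pi_gt_three]
  rw [poissonKernel, norm_div]
  refine (div_le_self (norm_nonneg _) hpi).trans ?_
  rw [norm_mul, norm_mul, hexp]
  have h3f : ((3 : ℕ).factorial : ℝ) = 6 := by norm_num [Nat.factorial]
  have h4f : ((4 : ℕ).factorial : ℝ) = 24 := by norm_num [Nat.factorial]
  have h5f : ((5 : ℕ).factorial : ℝ) = 120 := by norm_num [Nat.factorial]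
  rw [h3f] at b3
  rw [h4f] at b4
  rw [h5f] at b5
  calc ‖z‖ * Real.exp (-ρ.re) * ‖1 / ρ ^ 3 + 3 / ρ ^ 4 + 3 / ρ ^ 5‖
      ≤ ‖z‖ * Real.exp (-ρ.re) * ((‖ρ‖ ^ 3)⁻¹ + 3 * (‖ρ‖ ^ 4)⁻¹ + 3 * (‖ρ‖ ^ 5)⁻¹) := by gcongr
    _ = ‖z‖ * ((‖ρ‖ ^ 3)⁻¹ * Real.exp (-ρ.re) + 3 * ((‖ρ‖ ^ 4)⁻¹ * Real.exp (-ρ.re))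
          + 3 * ((‖ρ‖ ^ 5)⁻¹ * Real.exp (-ρ.re))) := by ring
    -- `438 = 3! + 3 · 4! + 3 · 5!`
    _ ≤ ‖z‖ * (438 * (p ^ 3)⁻¹) := by
        refine mul_le_mul_of_nonneg_left ?_ (norm_nonneg _)
        linarith
    _ = _ := by ring

/-! ### Damped waves as Schwartz functions -/

theorem hasTemperateGrowth_cexp_I_mul :
    HasTemperateGrowth fun r : ℝ => Complex.exp (Complex.I * r) := by
  have hiter : ∀ n : ℕ, iteratedDeriv n (fun r : ℝ => Complex.exp (Complex.I * r))
      = fun r : ℝ => Complex.I ^ n * Complex.exp (Complex.I * r) := by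
    intro n
    induction n with
    | zero => ext r; simp
    | succ n ih =>
      rw [iteratedDeriv_succ, ih]
      ext r
      have h := ((((hasDerivAt_id r).ofReal_comp).const_mul Complex.I).cexp).const_mul
        (Complex.I ^ n)
      refine h.deriv.trans ?_
      simp; ring
  refine ⟨(contDiff_const.mul Complex.ofRealCLM.contDiff).cexp, fun n => ⟨0, 1, fun r => ?_⟩⟩
  rw [norm_iteratedFDeriv_eq_norm_iteratedDeriv, hiter]
  simp only
  rw [mul_comm Complex.I, norm_mul, Complex.norm_exp_ofReal_mul_I]
  simp

theorem hasTemperateGrowth_cexp_I_mul_comp {E : Type*} [NormedAddCommGroup E] [NormedSpace ℝ E]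
    {φ : E → ℝ} (hφ : HasTemperateGrowth φ) :
    HasTemperateGrowth fun ξ => Complex.exp (Complex.I * ((φ ξ : ℝ) : ℂ)) :=
  hasTemperateGrowth_cexp_I_mul.comp hφ

theorem hasTemperateGrowth_freqBracket_rpow (s : ℝ) :
    HasTemperateGrowth fun ξ : Space => freqBracket ξ ^ s := by
  have h := (hasTemperateGrowth_one_add_norm_sq_rpow Space (s / 2)).comp
    ((2 * π) • ContinuousLinearMap.id ℝ Space).hasTemperateGrowth
  have e : (fun ξ : Space => freqBracket ξ ^ s) = (fun x : Space => (1 + ‖x‖ ^ 2) ^ (s / 2)) ∘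
      ((2 * π) • ContinuousLinearMap.id ℝ Space) := by
    ext ξ
    rw [← bracketPow_two_pi_smul]
    rfl
  rwa [e]

theorem hasTemperateGrowth_freqBracket : HasTemperateGrowth freqBracket := by
  simpa using hasTemperateGrowth_freqBracket_rpow 1

theorem hasTemperateGrowth_fderiv {E F : Type*} [NormedAddCommGroup E] [NormedSpace ℝ E]
    [NormedAddCommGroup F] [NormedSpace ℝ F] {f : E → F} (hf : HasTemperateGrowth f) :
    HasTemperateGrowth (fderiv ℝ f) := by
  refine ⟨hf.1.fderiv_right (by simp), fun n => ?_⟩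
  obtain ⟨k, C, h⟩ := hf.2 (n + 1)
  exact ⟨k, C, fun x => by rw [norm_iteratedFDeriv_fderiv]; exact h x⟩

/-- The derivatives of `exp (-s⟨2πξ⟩)` are `exp (-s⟨2πξ⟩)` times functions of temperate growth. -/
theorem exists_norm_iteratedFDeriv_exp_smul_le (s : ℝ) (n : ℕ) :
    ∀ {F : Type} [NormedAddCommGroup F] [NormedSpace ℝ F] {g : Space → F}, HasTemperateGrowth g →
      ∃ (k : ℕ) (C : ℝ), ∀ ξ,
        ‖iteratedFDeriv ℝ n (fun ξ => Real.exp (-(s * freqBracket ξ)) • g ξ) ξ‖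
          ≤ C * (1 + ‖ξ‖) ^ k * Real.exp (-(s * freqBracket ξ)) := by
  induction n with
  | zero =>
    intro F _ _ g hg
    obtain ⟨k, C, h⟩ := hg.2 0
    refine ⟨k, C, fun ξ => ?_⟩
    have := h ξ
    rw [norm_iteratedFDeriv_zero] at this ⊢
    rw [norm_smul, Real.norm_of_nonneg (Real.exp_pos _).le, mul_comm]
    gcongr
  | succ n ih =>
    intro F _ _ g hg
    have hb := hasTemperateGrowth_freqBracket
    let g' : Space → (Space →L[ℝ] F) := fun ξ => fderiv ℝ g ξ +
      (-s) • (ContinuousLinearMap.smulRightL ℝ Space F (fderiv ℝ freqBracket ξ) (g ξ))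
    have hg' : HasTemperateGrowth g' := by
      have h1 := hasTemperateGrowth_fderiv hg
      have h2 := (ContinuousLinearMap.smulRightL ℝ Space F).bilinear_hasTemperateGrowth
        (hasTemperateGrowth_fderiv hb) hg
      exact h1.add ((HasTemperateGrowth.const (-s)).smul h2)
    obtain ⟨k, C, h⟩ := ih hg'
    refine ⟨k, C, fun ξ => ?_⟩
    rw [← norm_iteratedFDeriv_fderiv]
    have hfd : fderiv ℝ (fun ξ => Real.exp (-(s * freqBracket ξ)) • g ξ)
        = fun ξ => Real.exp (-(s * freqBracket ξ)) • g' ξ := by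
      ext1 ξ
      have hdb : HasFDerivAt freqBracket (fderiv ℝ freqBracket ξ) ξ :=
        ((hb.1.differentiable (by simp)) ξ).hasFDerivAt
      have hdg : HasFDerivAt g (fderiv ℝ g ξ) ξ :=
        ((hg.1.differentiable (by simp)) ξ).hasFDerivAt
      have := (((hdb.const_mul s).neg).exp.smul hdg).fderiv
      refine this.trans ?_
      ext v
      simp [g', smul_smul]
    rw [hfd]
    exact h ξ

theorem norm_le_freqBracket (ξ : Space) : 1 + ‖ξ‖ ≤ 2 * freqBracket ξ := by
  have h1 := one_le_freqBracket ξ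
  have h2 : ‖ξ‖ ≤ freqBracket ξ := by
    refine (sq_le_sq₀ (norm_nonneg _) (freqBracket_pos ξ).le).1 ?_
    rw [freqBracket_sq]
    nlinarith [sq_nonneg ‖ξ‖, Real.pi_gt_three, sq_nonneg (π - 3)]
  linarith

/-- The function `exp (-s⟨2πξ⟩)`, `s > 0`, as a Schwartz function. -/
noncomputable def expSchwartz {s : ℝ} (hs : 0 < s) : 𝓢(Space, ℂ) where
  toFun ξ := Real.exp (-(s * freqBracket ξ)) • (1 : ℂ)
  smooth' := by
    have := hasTemperateGrowth_freqBracket.1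
    fun_prop
  decay' := by
    intro j n
    obtain ⟨k, C, h⟩ := exists_norm_iteratedFDeriv_exp_smul_le s n
      (HasTemperateGrowth.const (E := Space) (1 : ℂ))
    have hC : 0 ≤ C := by
      have := (norm_nonneg _).trans (h 0)
      simp at this
      by_contra! hcon
      nlinarith [Real.exp_pos (-(s * freqBracket 0))]
    refine ⟨C * (2 ^ (j + k) * ((j + k).factorial * s ^ (-((j + k : ℕ) : ℝ)))), fun ξ => ?_⟩
    have hl := freqBracket_pos ξ
    calc ‖ξ‖ ^ j * ‖iteratedFDeriv ℝ n (fun ξ => Real.exp (-(s * freqBracket ξ)) • (1 : ℂ)) ξ‖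
        ≤ (1 + ‖ξ‖) ^ j * (C * (1 + ‖ξ‖) ^ k * Real.exp (-(s * freqBracket ξ))) := by
          gcongr
          · linarith [norm_nonneg ξ]
          · exact h ξ
      _ = C * ((1 + ‖ξ‖) ^ (j + k) * Real.exp (-(s * freqBracket ξ))) := by rw [pow_add]; ring
      _ ≤ C * ((2 * freqBracket ξ) ^ (j + k) * ((j + k).factorial *
            (s * freqBracket ξ) ^ (-((j + k : ℕ) : ℝ)))) := by
          gcongr
          · exact norm_le_freqBracket ξ
          · exact exp_neg_le_factorial_mul_rpow (by positivity) _
      _ = _ := by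
          rw [Real.mul_rpow hs.le hl.le, mul_pow, Real.rpow_neg hl.le, Real.rpow_natCast]
          field_simp

theorem hasTemperateGrowth_phase (x : Space) (τ : ℝ) :
    HasTemperateGrowth fun ξ : Space =>
      Complex.exp (Complex.I * ((2 * π * inner ℝ ξ x - τ * freqBracket ξ : ℝ) : ℂ)) := by
  refine hasTemperateGrowth_cexp_I_mul_comp ?_
  have := hasTemperateGrowth_freqBracket
  fun_prop

/-- The Schwartz function `exp (2πi x·ξ - (s + iτ)⟨2πξ⟩)`. -/
noncomputable def waveSchwartz (x : Space) (τ : ℝ) {s : ℝ} (hs : 0 < s) : 𝓢(Space, ℂ) :=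
  SchwartzMap.smulLeftCLM ℂ (fun ξ : Space =>
    Complex.exp (Complex.I * ((2 * π * inner ℝ ξ x - τ * freqBracket ξ : ℝ) : ℂ))) (expSchwartz hs)

theorem waveSchwartz_apply (x : Space) (τ : ℝ) {s : ℝ} (hs : 0 < s) (ξ : Space) :
    waveSchwartz x τ hs ξ
      = Complex.exp (Complex.I * ((2 * π * inner ℝ ξ x - τ * freqBracket ξ : ℝ) : ℂ))
        * Real.exp (-(s * freqBracket ξ)) := by
  rw [waveSchwartz, SchwartzMap.smulLeftCLM_apply_apply (hasTemperateGrowth_phase x τ), smul_eq_mul]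
  congr 1
  change Real.exp (-(s * freqBracket ξ)) • (1 : ℂ) = _
  simp

theorem norm_waveSchwartz (x : Space) (τ : ℝ) {s : ℝ} (hs : 0 < s) (ξ : Space) :
    ‖waveSchwartz x τ hs ξ‖ = Real.exp (-(s * freqBracket ξ)) := by
  rw [waveSchwartz_apply, norm_mul, mul_comm Complex.I, Complex.norm_exp_ofReal_mul_I, one_mul,
    Complex.norm_real, Real.norm_of_nonneg (Real.exp_pos _).le]

theorem fourier_waveSchwartz (x : Space) (τ : ℝ) {s : ℝ} (hs : 0 < s) (y : Space) :
    𝓕 (waveSchwartz x τ hs) y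
      = 𝓕 (fun ξ : Space => Complex.exp (-((s + τ * Complex.I : ℂ) * freqBracket ξ))) (y - x) := by
  rw [SchwartzMap.fourier_coe, Real.fourier_eq', Real.fourier_eq']
  refine integral_congr_ae (Eventually.of_forall fun ξ => ?_)
  simp only [smul_eq_mul]
  rw [waveSchwartz_apply, Complex.ofReal_exp, ← Complex.exp_add, ← Complex.exp_add,
    ← Complex.exp_add]
  congr 1
  rw [inner_sub_right]
  push_cast
  ring

/-! ### Half waves on the Fourier side -/

theorem fourierMultiplierCLM_Lp_apply {m : Space → ℂ} (hm : HasTemperateGrowth m)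
    (G : Lp Spinor 2 (volume : Measure Space)) (φ : 𝓢(Space, ℂ)) :
    fourierMultiplierCLM Spinor m (G : 𝓢'(Space, Spinor)) φ
      = ∫ ξ, (𝓕⁻ φ) ξ • m ξ • (𝓕 G : Lp Spinor 2 (volume : Measure Space)) ξ := by
  rw [fourierMultiplierCLM_apply_apply, ← TemperedDistribution.fourier_apply,
    Lp.fourier_toTemperedDistribution_eq, Lp.toTemperedDistribution_apply]
  refine integral_congr_ae (Eventually.of_forall fun ξ => ?_)
  simp only
  rw [SchwartzMap.smulLeftCLM_apply_apply hm, smul_eq_mul, smul_smul, mul_comm]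

theorem bracketD_eq (s : ℝ) : bracketD s
    = fourierMultiplierCLM Spinor (fun ξ : Space => ((freqBracket ξ ^ s : ℝ) : ℂ)) := by
  unfold bracketD multiplier
  simp_rw [bracketPow_two_pi_smul]

theorem propagator_eq (τ : ℝ) : propagator τ = fourierMultiplierCLM Spinor
    (fun ξ : Space => Complex.exp (Complex.I * ((τ * freqBracket ξ : ℝ) : ℂ))) := by
  unfold propagator multiplier
  simp_rw [bracketPow_two_pi_smul, Real.rpow_one]

theorem hasTemperateGrowth_bracket_symbol (s : ℝ) :
    HasTemperateGrowth fun ξ : Space => ((freqBracket ξ ^ s : ℝ) : ℂ) :=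
  (Complex.hasTemperateGrowth_ofReal).comp (hasTemperateGrowth_freqBracket_rpow s)

theorem hasTemperateGrowth_propagator_symbol (τ : ℝ) :
    HasTemperateGrowth fun ξ : Space =>
      Complex.exp (Complex.I * ((τ * freqBracket ξ : ℝ) : ℂ)) := by
  refine hasTemperateGrowth_cexp_I_mul_comp ?_
  have := hasTemperateGrowth_freqBracket
  fun_prop

/-- A field `v` is recovered from `⟨D⟩^n v`. -/
theorem bracketD_neg_bracketD (n : ℝ) (v : 𝓢'(Space, Spinor)) :
    bracketD (-n) (bracketD n v) = v := by
  rw [bracketD_eq, bracketD_eq, fourierMultiplierCLM_fourierMultiplierCLM_apply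
    (hasTemperateGrowth_bracket_symbol _) (hasTemperateGrowth_bracket_symbol _)]
  have : ((fun ξ : Space => ((freqBracket ξ ^ n : ℝ) : ℂ)) *
      fun ξ : Space => ((freqBracket ξ ^ (-n) : ℝ) : ℂ)) = fun _ => (1 : ℂ) := by
    ext ξ
    rw [Pi.mul_apply, ← Complex.ofReal_mul, ← Real.rpow_add (freqBracket_pos ξ)]
    simp
  rw [this, fourierMultiplierCLM_const]
  simp

/-- The Fourier transform of the field `v` with `⟨D⟩^n v = G ∈ L²`. -/
noncomputable def freqAmplitude (n : ℝ) (G : Lp Spinor 2 (volume : Measure Space)) (ξ : Space) :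
    Spinor :=
  ((freqBracket ξ ^ (-n) : ℝ) : ℂ) • (𝓕 G : Lp Spinor 2 (volume : Measure Space)) ξ

theorem bracketD_apply_eq_integral {n : ℝ} {v : 𝓢'(Space, Spinor)}
    {G : Lp Spinor 2 (volume : Measure Space)} (hG : bracketD n v = (G : 𝓢'(Space, Spinor)))
    (k : ℝ) (φ : 𝓢(Space, ℂ)) :
    bracketD k v φ = ∫ ξ, (𝓕⁻ φ) ξ • ((freqBracket ξ ^ k : ℝ) : ℂ) • freqAmplitude n G ξ := by
  rw [← bracketD_neg_bracketD n v, hG, bracketD_eq, bracketD_eq,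
    fourierMultiplierCLM_fourierMultiplierCLM_apply (hasTemperateGrowth_bracket_symbol _)
      (hasTemperateGrowth_bracket_symbol _), fourierMultiplierCLM_Lp_apply
      ((hasTemperateGrowth_bracket_symbol _).mul (hasTemperateGrowth_bracket_symbol _))]
  refine integral_congr_ae (Eventually.of_forall fun ξ => ?_)
  simp only [freqAmplitude, Pi.mul_apply, smul_smul]
  congr 1
  ring

/-- Parseval's identity for the profile `h = exp (iτ⟨D⟩) v`, with `v` on the Fourier side. -/
theorem integral_smul_profile_eq {n τ : ℝ} {v : 𝓢'(Space, Spinor)}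
    {G h : Lp Spinor 2 (volume : Measure Space)} (hG : bracketD n v = (G : 𝓢'(Space, Spinor)))
    (hh : propagator τ v = (h : 𝓢'(Space, Spinor))) (S : 𝓢(Space, ℂ)) :
    ∫ y, (𝓕 S) y • h y = ∫ ξ, (S ξ * Complex.exp (Complex.I * ((τ * freqBracket ξ : ℝ) : ℂ)))
      • freqAmplitude n G ξ := by
  rw [← Lp.toTemperedDistribution_apply, ← hh, ← bracketD_neg_bracketD n v, hG, bracketD_eq,
    propagator_eq, fourierMultiplierCLM_fourierMultiplierCLM_apply
      (hasTemperateGrowth_bracket_symbol _) (hasTemperateGrowth_propagator_symbol _),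
    fourierMultiplierCLM_Lp_apply ((hasTemperateGrowth_bracket_symbol _).mul
      (hasTemperateGrowth_propagator_symbol _)), FourierTransform.fourierInv_fourier_eq]
  refine integral_congr_ae (Eventually.of_forall fun ξ => ?_)
  simp only [freqAmplitude, Pi.mul_apply]
  rw [smul_smul, smul_smul]
  congr 1
  ring

/-- The damped half wave as a convolution of the profile with the damped propagation kernel. -/
theorem integral_exp_smul_freqAmplitude_eq {n τ : ℝ} {v : 𝓢'(Space, Spinor)}
    {G h : Lp Spinor 2 (volume : Measure Space)} (hG : bracketD n v = (G : 𝓢'(Space, Spinor)))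
    (hh : propagator τ v = (h : 𝓢'(Space, Spinor))) (x : Space) {s : ℝ} (hs : 0 < s) :
    ∫ ξ, 𝐞 (inner ℝ ξ x) • Real.exp (-(s * freqBracket ξ)) • freqAmplitude n G ξ
      = ∫ y, 𝓕 (waveSchwartz x τ hs) y • h y := by
  rw [integral_smul_profile_eq hG hh]
  refine integral_congr_ae (Eventually.of_forall fun ξ => ?_)
  simp only
  rw [waveSchwartz_apply, Circle.smul_def, Real.fourierChar_apply, ← Complex.coe_smul, smul_smul]
  refine congrArg (· • freqAmplitude n G ξ) ?_
  rw [mul_right_comm (Complex.exp _), ← Complex.exp_add]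
  congr 2
  push_cast
  ring

/-- A distribution whose Fourier transform is an integrable function `w` is the function given by
the inversion integral of `w`, so that bounds of this integral are bounds in `L^∞`. -/
theorem distLpNorm_top_le {w : Space → Spinor} (hw : Integrable w) {u : 𝓢'(Space, Spinor)}
    (hu : ∀ φ : 𝓢(Space, ℂ), u φ = ∫ ξ, (𝓕⁻ φ) ξ • w ξ) {B : ℝ}
    (hB : ∀ x, ‖∫ ξ, 𝐞 (inner ℝ ξ x) • w ξ‖ ≤ B) :
    distLpNorm ∞ u ≤ ENNReal.ofReal B := by
  let U : Space → Spinor := fun x => ∫ ξ, 𝐞 (inner ℝ ξ x) • w ξ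
  have hUeq : ∀ x, U x = VectorFourier.fourierIntegral 𝐞 volume (-innerₗ Space) w x := by
    intro x
    simp [U, VectorFourier.fourierIntegral]
  have hcont' : Continuous fun p : Space × Space => (-innerₗ Space) p.1 p.2 := by
    simp only [LinearMap.neg_apply, innerₗ_apply_apply]
    fun_prop
  have hUc : Continuous U := by
    rw [funext hUeq]
    exact VectorFourier.fourierIntegral_continuous continuous_fourierChar hcont' hw
  have hmem : MemLp U ∞ (volume : Measure Space) :=
    memLp_top_of_bound hUc.aestronglyMeasurable B (Eventually.of_forall hB)
  have hrep : u = ((hmem.toLp U : Lp Spinor ∞ (volume : Measure Space)) : 𝓢'(Space, Spinor)) := by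
    ext1 φ
    rw [hu, Lp.toTemperedDistribution_apply]
    have e1 : ∫ y, φ y • (hmem.toLp U : Lp Spinor ∞ (volume : Measure Space)) y
        = ∫ y, φ y • VectorFourier.fourierIntegral 𝐞 volume (-innerₗ Space) w y := by
      refine integral_congr_ae ?_
      filter_upwards [hmem.coeFn_toLp] with y hy
      rw [hy, hUeq]
    rw [e1]
    have h := VectorFourier.integral_fourierIntegral_smul_eq_flip (μ := (volume : Measure Space))
      (ν := (volume : Measure Space)) (e := 𝐞) (L := -innerₗ Space) (f := φ) (g := w)
      continuous_fourierChar hcont' φ.integrable hw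
    have hflip : (-innerₗ Space).flip = -innerₗ Space := by
      ext a b
      simp [real_inner_comm]
    rw [hflip] at h
    rw [← h]
    refine integral_congr_ae (Eventually.of_forall fun ξ => ?_)
    simp only
    congr 1
    rw [SchwartzMap.fourierInv_coe, Real.fourierInv_eq]
    simp [VectorFourier.fourierIntegral]
  refine (iInf₂_le (hmem.toLp U) hrep).trans ?_
  rw [eLpNorm_congr_ae hmem.coeFn_toLp, eLpNorm_exponent_top]
  exact eLpNormEssSup_le_of_ae_bound (Eventually.of_forall hB)

/-! ### Powers as superpositions of exponentials -/

/-- The function `(1 - e^(-u))^M e^(-u)`: a finite combination of the exponentials `e^(-j u)` with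
`j ≥ 1` that vanishes to order `M` at `u = 0`. -/
noncomputable def expBump (M : ℕ) (u : ℝ) : ℝ := (1 - Real.exp (-u)) ^ M * Real.exp (-u)

theorem expBump_nonneg (M : ℕ) {u : ℝ} (hu : 0 ≤ u) : 0 ≤ expBump M u := by
  have : Real.exp (-u) ≤ 1 := Real.exp_le_one_iff.2 (by linarith)
  exact mul_nonneg (pow_nonneg (by linarith) _) (Real.exp_pos _).le

theorem expBump_le_pow_mul_exp (M : ℕ) {u : ℝ} (hu : 0 ≤ u) :
    expBump M u ≤ u ^ M * Real.exp (-u) := by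
  have h1 : Real.exp (-u) ≤ 1 := Real.exp_le_one_iff.2 (by linarith)
  have h2 := Real.add_one_le_exp (-u)
  unfold expBump
  gcongr
  · linarith

theorem expBump_le_pow (M : ℕ) {u : ℝ} (hu : 0 ≤ u) : expBump M u ≤ u ^ M :=
  (expBump_le_pow_mul_exp M hu).trans
    (mul_le_of_le_one_right (by positivity) (Real.exp_le_one_iff.2 (by linarith)))

theorem continuous_expBump (M : ℕ) : Continuous (expBump M) := by
  unfold expBump; fun_prop

theorem expBump_eq_sum (M : ℕ) (s l : ℝ) : expBump M (s * l)
    = ∑ j ∈ Finset.range (M + 1), ((-1) ^ j * (M.choose j : ℝ)) *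
        Real.exp (-((((j : ℝ) + 1) * s) * l)) := by
  have h := add_pow (-Real.exp (-(s * l))) 1 M
  rw [expBump, show 1 - Real.exp (-(s * l)) = -Real.exp (-(s * l)) + 1 by ring, h, Finset.sum_mul]
  refine Finset.sum_congr rfl fun j _ => ?_
  have e : Real.exp (-((((j : ℝ) + 1) * s) * l))
      = Real.exp (-(s * l)) ^ j * Real.exp (-(s * l)) := by
    rw [← Real.exp_nat_mul, ← Real.exp_add]; congr 1; ring
  rw [e, neg_pow]
  ring

theorem integrableOn_expBump_mul_rpow {M : ℕ} {k : ℝ} (hkM : k < M) :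
    IntegrableOn (fun u => expBump M u * u ^ (-k - 1)) (Ioi 0) := by
  have h := Real.GammaIntegral_convergent (s := M - k) (by linarith)
  refine Integrable.mono' h ?_ ?_
  · exact ((continuous_expBump M).measurable.mul (by fun_prop)).aestronglyMeasurable
  · filter_upwards [ae_restrict_mem measurableSet_Ioi] with u hu
    have hu' : (0 : ℝ) < u := hu
    rw [Real.norm_of_nonneg (mul_nonneg (expBump_nonneg M hu'.le) (by positivity))]
    calc expBump M u * u ^ (-k - 1) ≤ (u ^ M * Real.exp (-u)) * u ^ (-k - 1) := by
          gcongr; exact expBump_le_pow_mul_exp M hu'.le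
      _ = Real.exp (-u) * u ^ (M - k - 1) := by
          rw [show (M : ℝ) - k - 1 = M + (-k - 1) by ring, Real.rpow_add hu', Real.rpow_natCast]
          ring

/-- The normalizing constant `∫ (1 - e^(-u))^M e^(-u) u^(-k-1) du` over the half line. -/
noncomputable def bumpConst (M : ℕ) (k : ℝ) : ℝ :=
  ∫ u in Ioi (0 : ℝ), expBump M u * u ^ (-k - 1)

/-- The power `l ^ k` as a superposition of exponentials `e^(-s l)`, by scaling. -/
theorem integral_expBump_mul_rpow (M : ℕ) (k : ℝ) {l : ℝ} (hl : 0 < l) :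
    ∫ s in Ioi (0 : ℝ), s ^ (-k - 1) * expBump M (s * l) = bumpConst M k * l ^ k := by
  have h := integral_comp_mul_right_Ioi (fun u => expBump M u * u ^ (-k - 1)) 0 hl
  rw [zero_mul, smul_eq_mul] at h
  change _ = l⁻¹ * bumpConst M k at h
  have e : ∫ s in Ioi (0 : ℝ), s ^ (-k - 1) * expBump M (s * l)
      = ∫ s in Ioi (0 : ℝ), l ^ (k + 1) * (expBump M (s * l) * (s * l) ^ (-k - 1)) := by
    refine setIntegral_congr_fun measurableSet_Ioi fun s hs => ?_
    have hs' : (0 : ℝ) < s := hs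
    have : l ^ (k + 1) * l ^ (-k - 1) = 1 := by
      rw [← Real.rpow_add hl]; simp
    rw [Real.mul_rpow hs'.le hl.le]
    linear_combination (-(s ^ (-k - 1) * expBump M (s * l))) * this
  rw [e, integral_const_mul, h, Real.rpow_add_one hl.ne']
  field_simp

theorem integrableOn_rpow_mul_expBump {M : ℕ} {k : ℝ} (hkM : k < M) {l : ℝ} (hl : 0 < l) :
    IntegrableOn (fun s => s ^ (-k - 1) * expBump M (s * l)) (Ioi 0) := by
  have h := (integrableOn_Ioi_comp_mul_right_iff (fun u => expBump M u * u ^ (-k - 1)) 0 hl).2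
    (by rw [zero_mul]; exact integrableOn_expBump_mul_rpow hkM)
  refine (h.const_mul (l ^ (k + 1))).congr ?_
  filter_upwards [ae_restrict_mem measurableSet_Ioi] with s hs
  have hs' : (0 : ℝ) < s := hs
  have : l ^ (k + 1) * l ^ (-k - 1) = 1 := by
    rw [← Real.rpow_add hl]; simp
  rw [Real.mul_rpow hs'.le hl.le]
  linear_combination (s ^ (-k - 1) * expBump M (s * l)) * this

theorem exists_pos_le_bumpConst (M : ℕ) (N : ℝ) :
    ∃ c : ℝ, 0 < c ∧ ∀ k : ℝ, k ≤ N → k < M → c ≤ bumpConst M k := by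
  refine ⟨(1 - Real.exp (-1)) ^ M * Real.exp (-2) * 2 ^ (-|N| - 1), ?_, fun k hkN hkM => ?_⟩
  · have : Real.exp (-1) < 1 := by simp
    have : 0 < 1 - Real.exp (-1) := by linarith
    positivity
  · have hI := integrableOn_expBump_mul_rpow hkM
    have hsub : Ioc (1 : ℝ) 2 ⊆ Ioi 0 := fun x hx => lt_trans one_pos hx.1
    have hnn : 0 ≤ᵐ[volume.restrict (Ioi (0 : ℝ))] fun u => expBump M u * u ^ (-k - 1) := by
      filter_upwards [ae_restrict_mem measurableSet_Ioi] with u hu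
      have hu' : (0 : ℝ) < u := hu
      exact mul_nonneg (expBump_nonneg M hu'.le) (by positivity)
    refine le_trans ?_ (setIntegral_mono_set hI hnn hsub.eventuallyLE)
    have hc : ∫ u in Ioc (1 : ℝ) 2, ((1 - Real.exp (-1)) ^ M * Real.exp (-2) * 2 ^ (-|N| - 1))
        = (1 - Real.exp (-1)) ^ M * Real.exp (-2) * 2 ^ (-|N| - 1) := by
      rw [setIntegral_const]; simp; norm_num
    rw [← hc]
    refine setIntegral_mono_on (integrableOn_const (by simp))
      (hI.mono_set hsub) measurableSet_Ioc fun u hu => ?_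
    have hu0 : 0 < u := hsub hu
    have h1 : Real.exp (-u) ≤ Real.exp (-1) := Real.exp_le_exp.2 (by linarith [hu.1])
    have h2 : Real.exp (-2) ≤ Real.exp (-u) := Real.exp_le_exp.2 (by linarith [hu.2])
    have h3 : Real.exp (-1) < 1 := by simp
    have h4 : (2 : ℝ) ^ (-|N| - 1) ≤ u ^ (-k - 1) := by
      have hN := le_abs_self N
      have hN0 := abs_nonneg N
      calc (2 : ℝ) ^ (-|N| - 1) ≤ u ^ (-|N| - 1) :=
            Real.rpow_le_rpow_of_nonpos hu0 hu.2 (by linarith)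
        _ ≤ _ := Real.rpow_le_rpow_of_exponent_le hu.1.le (by linarith)
    have h5 : 0 ≤ 1 - Real.exp (-u) := by linarith
    unfold expBump
    gcongr

/-- A bound for a frequency integral with the weight `l ^ k` from bounds for the damped integrals
with the weights `e^(-s l)`, `s ≥ ε`, and from the mass at high frequencies. -/
theorem bumpConst_mul_norm_integral_le {α E : Type*} [MeasurableSpace α] {μ : Measure α} [SFinite μ]
    [NormedAddCommGroup E] [NormedSpace ℝ E] [CompleteSpace E] {l : α → ℝ} (hlm : Measurable l)
    (hl : ∀ a, 1 ≤ l a) {g : α → E} (hg : AEStronglyMeasurable g μ) {M : ℕ}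
    (hM : Integrable (fun a => l a ^ M * ‖g a‖) μ) {k : ℝ} (hk : 0 ≤ k) (hkM : k + 1 ≤ M)
    {ε B : ℝ} (hε : 0 < ε) (hB : 0 ≤ B)
    (hdamp : ∀ s, ε ≤ s → ‖∫ a, Real.exp (-(s * l a)) • g a ∂μ‖ ≤ B * s ^ (-2 : ℝ)) :
    bumpConst M k * ‖∫ a, l a ^ k • g a ∂μ‖
      ≤ ε ^ (M - k) * ∫ a, l a ^ M * ‖g a‖ ∂μ + 2 ^ M * B * ε ^ (-(k + 2)) := by
  have hl0 : ∀ a, 0 < l a := fun a => one_pos.trans_le (hl a)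
  have hkM' : k < M := by linarith
  set I := ∫ a, l a ^ M * ‖g a‖ ∂μ with hI
  have hIpos : 0 ≤ I := integral_nonneg fun a => by have := hl0 a; positivity
  have hgint : Integrable g μ := by
    refine hM.mono hg (Eventually.of_forall fun a => ?_)
    rw [norm_mul, norm_norm, norm_pow, Real.norm_of_nonneg (hl0 a).le]
    exact le_mul_of_one_le_left (norm_nonneg _) (one_le_pow₀ (hl a))
  have hcpos : 0 ≤ bumpConst M k := setIntegral_nonneg measurableSet_Ioi fun u hu => by
    have hu' : (0 : ℝ) < u := hu
    exact mul_nonneg (expBump_nonneg M hu'.le) (by positivity)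
  let F : α → ℝ → E := fun a s => (s ^ (-k - 1) * expBump M (s * l a)) • g a
  have hFmeas : AEStronglyMeasurable (Function.uncurry F)
      (μ.prod (volume.restrict (Ioi (0 : ℝ)))) := by
    refine AEStronglyMeasurable.smul ?_ hg.comp_fst
    have h1 : Measurable fun p : α × ℝ => p.2 * l p.1 :=
        measurable_snd.mul (hlm.comp measurable_fst)
    exact ((measurable_snd.pow_const _).mul
      ((continuous_expBump M).measurable.comp h1)).aestronglyMeasurable
  have hnormF : ∀ a, ∀ s : ℝ, 0 < s → ‖F a s‖ = s ^ (-k - 1) * expBump M (s * l a) * ‖g a‖ := by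
    intro a s hs
    have := expBump_nonneg M (mul_nonneg hs.le (hl0 a).le)
    simp only [F]
    rw [norm_smul, Real.norm_of_nonneg (by positivity)]
  have hFint : Integrable (Function.uncurry F) (μ.prod (volume.restrict (Ioi (0 : ℝ)))) := by
    rw [integrable_prod_iff hFmeas]
    constructor
    · exact Eventually.of_forall fun a =>
        (integrableOn_rpow_mul_expBump hkM' (hl0 a)).smul_const (g a)
    · have e : ∀ a, ∫ s in Ioi (0 : ℝ), ‖Function.uncurry F (a, s)‖
          = bumpConst M k * (l a ^ k * ‖g a‖) := by
        intro a
        rw [← mul_assoc, ← integral_expBump_mul_rpow M k (hl0 a), ← integral_mul_const]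
        exact setIntegral_congr_fun measurableSet_Ioi fun s hs => hnormF a s hs
      simp_rw [e]
      refine Integrable.const_mul ?_ _
      refine hM.mono ((hlm.pow_const k).aestronglyMeasurable.mul hg.norm)
        (Eventually.of_forall fun a => ?_)
      have h0 := hl0 a
      rw [Real.norm_of_nonneg (by positivity), Real.norm_of_nonneg (by positivity)]
      gcongr
      rw [← Real.rpow_natCast]
      exact Real.rpow_le_rpow_of_exponent_le (hl a) hkM'.le
  have hswap := integral_integral_swap hFint
  have hleft : ∫ a, (∫ s in Ioi (0 : ℝ), F a s) ∂μ = bumpConst M k • ∫ a, l a ^ k • g a ∂μ := by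
    rw [← integral_smul]
    refine integral_congr_ae (Eventually.of_forall fun a => ?_)
    simp only [F]
    rw [integral_smul_const, integral_expBump_mul_rpow M k (hl0 a), mul_smul]
  have hlow : ∀ s : ℝ, 0 < s → ‖∫ a, F a s ∂μ‖ ≤ I * s ^ (M - k - 1) := by
    intro s hs
    have hb : ∀ a, ‖F a s‖ ≤ s ^ (M - k - 1) * (l a ^ M * ‖g a‖) := by
      intro a
      rw [hnormF a s hs, show (M : ℝ) - k - 1 = (-k - 1) + M by ring, Real.rpow_add hs,
        Real.rpow_natCast]
      calc _ ≤ s ^ (-k - 1) * (s * l a) ^ M * ‖g a‖ := by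
            gcongr; exact expBump_le_pow M (mul_nonneg hs.le (hl0 a).le)
        _ = _ := by rw [mul_pow]; ring
    refine (norm_integral_le_of_norm_le (hM.const_mul _) (Eventually.of_forall hb)).trans
      (le_of_eq ?_)
    rw [integral_const_mul, mul_comm]
  have hhigh : ∀ s : ℝ, ε ≤ s → ‖∫ a, F a s ∂μ‖ ≤ 2 ^ M * B * s ^ (-k - 3) := by
    intro s hs
    have hs0 : 0 < s := hε.trans_le hs
    have hexpint : ∀ c : ℝ, 0 ≤ c → Integrable (fun a => Real.exp (-(c * l a)) • g a) μ := by
      intro c hc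
      refine hgint.mono
          ((by fun_prop : Measurable fun a => Real.exp (-(c * l a))).aestronglyMeasurable.smul hg)
        (Eventually.of_forall fun a => ?_)
      rw [norm_smul, Real.norm_of_nonneg (Real.exp_pos _).le]
      refine mul_le_of_le_one_left (norm_nonneg _) (Real.exp_le_one_iff.2 ?_)
      have := mul_nonneg hc (hl0 a).le
      linarith
    have e : ∫ a, F a s ∂μ = s ^ (-k - 1) • ∑ j ∈ Finset.range (M + 1),
        ((-1) ^ j * (M.choose j : ℝ)) • ∫ a, Real.exp (-((((j : ℝ) + 1) * s) * l a)) • g a ∂μ := by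
      simp_rw [← integral_smul]
      rw [← integral_finsetSum _ fun j _ => ?_, ← integral_smul]
      swap
      · exact (hexpint _ (by positivity)).smul _
      refine integral_congr_ae (Eventually.of_forall fun a => ?_)
      simp only [F]
      rw [expBump_eq_sum, mul_smul, Finset.sum_smul]
      simp_rw [smul_smul]
    have hsum : ‖∑ j ∈ Finset.range (M + 1),
        ((-1) ^ j * (M.choose j : ℝ)) • ∫ a, Real.exp (-((((j : ℝ) + 1) * s) * l a)) • g a ∂μ‖
        ≤ ∑ j ∈ Finset.range (M + 1), (M.choose j : ℝ) * (B * s ^ (-2 : ℝ)) := by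
      refine (norm_sum_le _ _).trans (Finset.sum_le_sum fun j _ => ?_)
      rw [norm_smul, norm_mul, norm_pow, norm_neg, norm_one, one_pow, one_mul,
        Real.norm_of_nonneg (by positivity)]
      have hj : s ≤ ((j : ℝ) + 1) * s :=
          le_mul_of_one_le_left hs0.le (by linarith [j.cast_nonneg (α := ℝ)])
      gcongr
      refine (hdamp _ (hs.trans hj)).trans ?_
      gcongr B * ?_
      exact Real.rpow_le_rpow_of_nonpos hs0 hj (by norm_num)
    have hchoose : ∑ j ∈ Finset.range (M + 1), (M.choose j : ℝ) = 2 ^ M := by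
      exact_mod_cast Nat.sum_range_choose M
    rw [← Finset.sum_mul, hchoose] at hsum
    rw [e, norm_smul, Real.norm_of_nonneg (by positivity),
      show (-k - 3 : ℝ) = (-k - 1) + (-2) by ring, Real.rpow_add hs0]
    calc _ ≤ s ^ (-k - 1) * (2 ^ M * (B * s ^ (-2 : ℝ))) := by gcongr
      _ = _ := by ring
  have hNint : IntegrableOn (fun s => ∫ a, F a s ∂μ) (Ioi 0) := hFint.integral_prod_right
  have hunion : Ioi (0 : ℝ) = Ioc 0 ε ∪ Ioi ε := (Ioc_union_Ioi_eq_Ioi hε.le).symm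
  have hsplit : ∫ s in Ioi (0 : ℝ), ∫ a, F a s ∂μ
      = (∫ s in Ioc 0 ε, ∫ a, F a s ∂μ) + ∫ s in Ioi ε, ∫ a, F a s ∂μ := by
    rw [hunion]
    exact setIntegral_union Ioc_disjoint_Ioi_same measurableSet_Ioi
      (hNint.mono_set Ioc_subset_Ioi_self) (hNint.mono_set (Ioi_subset_Ioi hε.le))
  have hpart1 : ‖∫ s in Ioc 0 ε, ∫ a, F a s ∂μ‖ ≤ ε ^ (M - k) * I := by
    have hint : IntegrableOn (fun s : ℝ => s ^ (M - k - 1)) (Ioc 0 ε) := by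
      have := (intervalIntegral.intervalIntegrable_rpow' (a := 0) (b := ε) (r := M - k - 1)
        (by linarith)).1
      exact this
    refine (norm_integral_le_of_norm_le (hint.const_mul I) ?_).trans ?_
    · filter_upwards [ae_restrict_mem measurableSet_Ioc] with s hs using hlow s hs.1
    · rw [integral_const_mul, ← intervalIntegral.integral_of_le hε.le,
        integral_rpow (Or.inl (by linarith)), sub_add_cancel,
          Real.zero_rpow (by linarith), sub_zero,
        mul_comm]
      gcongr
      exact div_le_self (by positivity) (by linarith)
  have hpart2 : ‖∫ s in Ioi ε, ∫ a, F a s ∂μ‖ ≤ 2 ^ M * B * ε ^ (-(k + 2)) := by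
    have hint := integrableOn_Ioi_rpow_of_lt (a := -k - 3) (c := ε) (by linarith) hε
    refine (norm_integral_le_of_norm_le (hint.const_mul (2 ^ M * B)) ?_).trans ?_
    · filter_upwards [ae_restrict_mem measurableSet_Ioi] with s hs using hhigh s (le_of_lt hs)
    · rw [integral_const_mul, integral_Ioi_rpow_of_lt (by linarith) hε,
        show -k - 3 + 1 = -(k + 2) by ring, neg_div_neg_eq]
      gcongr
      exact div_le_self (by positivity) (by linarith)
  calc bumpConst M k * ‖∫ a, l a ^ k • g a ∂μ‖ = ‖∫ s in Ioi (0 : ℝ), ∫ a, F a s ∂μ‖ := by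
        rw [← hswap, hleft, norm_smul, Real.norm_of_nonneg hcpos]
    _ ≤ _ := by rw [hsplit]; exact (norm_add_le _ _).trans (add_le_add hpart1 hpart2)

/-! ### Decay of damped half waves -/

theorem integral_norm_mul_norm_le {α E F : Type*} [MeasurableSpace α] {μ : Measure α}
    [NormedAddCommGroup E] [NormedAddCommGroup F] {f : α → E} {g : α → F}
    (hf : MemLp f 2 μ) (hg : MemLp g 2 μ) :
    Integrable (fun x => ‖f x‖ * ‖g x‖) μ ∧
      ∫ x, ‖f x‖ * ‖g x‖ ∂μ ≤ (eLpNorm f 2 μ).toReal * (eLpNorm g 2 μ).toReal := by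
  have hfg : MemLp (fun x => ‖f x‖ * ‖g x‖) 1 μ := hg.norm.smul (r := 1) hf.norm
  refine ⟨memLp_one_iff_integrable.1 hfg, ?_⟩
  have h := eLpNorm_smul_le_mul_eLpNorm (p := 2) (q := 2) (r := 1) hg.norm.1 hf.norm.1
  rw [eLpNorm_norm, eLpNorm_norm, eLpNorm_one_eq_lintegral_enorm] at h
  have e : ∫ x, ‖f x‖ * ‖g x‖ ∂μ = ∫ x, ‖‖f x‖ * ‖g x‖‖ ∂μ := by
    refine integral_congr_ae (Eventually.of_forall fun x => ?_)
    simp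
  rw [e, integral_norm_eq_lintegral_enorm hfg.1, ← ENNReal.toReal_mul]
  exact ENNReal.toReal_mono (ENNReal.mul_ne_top hf.2.ne hg.2.ne) h

/-- The weight `(1 + |y|²)^(-1-γ)` on `ℝ⁴`; it is square integrable for `γ > 0` but not for
`γ = 0`. -/
noncomputable def decayWeight (γ : ℝ) (y : Space) : ℝ := (1 + ‖y‖ ^ 2) ^ (-1 - γ)

theorem memLp_decayWeight {γ : ℝ} (hγ : 0 < γ) :
    MemLp (decayWeight γ) 2 (volume : Measure Space) := by
  have hm : Measurable (decayWeight γ) := by unfold decayWeight; fun_prop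
  rw [memLp_two_iff_integrable_sq hm.aestronglyMeasurable]
  have h := integrable_rpow_neg_one_add_norm_sq (E := Space) (μ := volume) (r := 4 * (1 + γ))
    (by simp; linarith)
  refine h.congr (Eventually.of_forall fun y => ?_)
  simp only [decayWeight]
  rw [← Real.rpow_natCast (_ ^ (-1 - γ)), ← Real.rpow_mul (by positivity)]
  congr 1; push_cast; ring

theorem memLp_freqBracket_rpow : MemLp (fun ξ : Space => freqBracket ξ ^ (-3 : ℝ)) 2 volume := by
  have hm : Measurable fun ξ : Space => freqBracket ξ ^ (-3 : ℝ) :=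
    continuous_freqBracket.measurable.pow_const _
  rw [memLp_two_iff_integrable_sq hm.aestronglyMeasurable]
  refine (integrable_freqBracket_rpow_neg (r := 6) (by norm_num)).congr
    (Eventually.of_forall fun ξ => ?_)
  simp only
  rw [← Real.rpow_natCast, ← Real.rpow_mul (freqBracket_pos ξ).le]
  congr 1; norm_num

theorem eLpNorm_fourier_waveSchwartz_le (x : Space) (τ : ℝ) {s : ℝ} (hs : 0 < s) :
    (eLpNorm (𝓕 (waveSchwartz x τ hs) : 𝓢(Space, ℂ)) 2 volume).toReal
      ≤ 6 * s ^ (-3 : ℝ) * (eLpNorm (fun ξ : Space => freqBracket ξ ^ (-3 : ℝ)) 2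
          volume).toReal := by
  have h := SchwartzMap.norm_fourier_toL2_eq (waveSchwartz x τ hs)
  rw [SchwartzMap.norm_toLp, SchwartzMap.norm_toLp] at h
  rw [h]
  have hb : eLpNorm (waveSchwartz x τ hs) 2 volume
      ≤ eLpNorm ((6 * s ^ (-3 : ℝ)) • fun ξ : Space => freqBracket ξ ^ (-3 : ℝ)) 2 volume := by
    refine eLpNorm_mono fun ξ => ?_
    have hl := freqBracket_pos ξ
    rw [norm_waveSchwartz, Pi.smul_apply, smul_eq_mul, Real.norm_of_nonneg (by positivity)]
    refine (exp_neg_le_factorial_mul_rpow (mul_pos hs hl) 3).trans (le_of_eq ?_)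
    rw [Real.mul_rpow hs.le hl.le]
    norm_num [Nat.factorial]
    ring
  refine (ENNReal.toReal_mono ?_ hb).trans (le_of_eq ?_)
  · exact (memLp_freqBracket_rpow.const_smul _).2.ne
  · rw [eLpNorm_const_smul, ENNReal.toReal_mul, toReal_enorm, Real.norm_of_nonneg (by positivity)]

theorem norm_fourier_waveSchwartz_le (x : Space) {τ s ε : ℝ} (hs : 0 < s) (hτ : 1 ≤ |τ|)
    (hε : 0 < ε) (hε1 : ε ≤ 1) (hετ : 1 ≤ ε * |τ|) (hεs : ε ≤ s) (y : Space) :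
    ‖𝓕 (waveSchwartz x τ hs) y‖ ≤ 876 * (ε⁻¹ * s ^ (-2 : ℝ) * (|τ| ^ 2)⁻¹) := by
  have ht : 0 < |τ| := by linarith
  rw [fourier_waveSchwartz]
  have hre : (s + τ * Complex.I : ℂ).re = s := by simp
  have him : (s + τ * Complex.I : ℂ).im = τ := by simp
  have h := norm_fourier_exp_neg_mul_freqBracket_le (z := s + τ * Complex.I) (by rw [hre]; exact hs)
    (by rw [hre, him]; nlinarith) (y - x)
  rw [hre, him] at h
  refine h.trans ?_
  have hn : ‖(s + τ * Complex.I : ℂ)‖ ≤ s + |τ| := by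
    refine (norm_add_le _ _).trans (le_of_eq ?_)
    simp [abs_of_pos hs]
  have e2 : s ^ (-2 : ℝ) = (s ^ 2)⁻¹ := by
    rw [Real.rpow_neg hs.le]; norm_cast
  have i1 : |τ|⁻¹ ≤ ε⁻¹ := inv_anti₀ hε (hε1.trans hτ)
  have i2 : s⁻¹ ≤ ε⁻¹ := inv_anti₀ hε hεs
  calc 438 * (‖(s + τ * Complex.I : ℂ)‖ * ((s * |τ|) ^ 3)⁻¹)
      ≤ 438 * ((s + |τ|) * ((s * |τ|) ^ 3)⁻¹) := by gcongr
    _ = 438 * ((|τ|⁻¹ + s⁻¹) * ((s ^ 2)⁻¹ * (|τ| ^ 2)⁻¹)) := by field_simp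
    _ ≤ 438 * ((ε⁻¹ + ε⁻¹) * ((s ^ 2)⁻¹ * (|τ| ^ 2)⁻¹)) := by gcongr
    _ = _ := by rw [e2]; ring

/-- Splitting at `|y| = t`: inside, the weight `(1 + |y|²)^(-1-γ)` is square integrable at the
cost of a factor `(1 + t²)^γ`; outside, the decay of the profile gains `t^(-2)`. -/
theorem norm_le_of_weighted {γ t : ℝ} (hγ : 0 ≤ γ) (ht : 0 < t) (y : Space) {a : ℝ} (ha : 0 ≤ a) :
    a ≤ (1 + t ^ 2) ^ γ * (decayWeight γ y * ((1 + ‖y‖ ^ 2) * a))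
      + (t ^ 2)⁻¹ * ((1 + ‖y‖ ^ 2) * a) := by
  have hw : 0 ≤ decayWeight γ y := by unfold decayWeight; positivity
  rcases le_or_gt ‖y‖ t with h | h
  · have e : decayWeight γ y * ((1 + ‖y‖ ^ 2) * a) = (1 + ‖y‖ ^ 2) ^ (-γ) * a := by
      have : (1 + ‖y‖ ^ 2) ^ (-1 - γ) * (1 + ‖y‖ ^ 2) = (1 + ‖y‖ ^ 2) ^ (-γ) := by
        rw [← Real.rpow_add_one (by positivity)]; congr 1; ring
      rw [decayWeight, ← mul_assoc, this]
    have h1 : 1 ≤ (1 + t ^ 2) ^ γ * (1 + ‖y‖ ^ 2) ^ (-γ) := by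
      rw [Real.rpow_neg (by positivity), ← div_eq_mul_inv, one_le_div (by positivity)]
      gcongr
    have h2 : 0 ≤ (t ^ 2)⁻¹ * ((1 + ‖y‖ ^ 2) * a) := by positivity
    rw [e, ← mul_assoc]
    nlinarith
  · have h1 : 1 ≤ (t ^ 2)⁻¹ * (1 + ‖y‖ ^ 2) := by
      rw [inv_mul_eq_div, one_le_div (by positivity)]
      nlinarith
    have h2 : 0 ≤ (1 + t ^ 2) ^ γ * (decayWeight γ y * ((1 + ‖y‖ ^ 2) * a)) := by positivity
    rw [← mul_assoc]
    nlinarith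

theorem norm_integral_smul_le_of_weighted {P : 𝓢(Space, ℂ)} {h : Space → Spinor} {γ t Pinf : ℝ}
    (hγ : 0 < γ) (ht : 0 < t) (hP : ∀ y, ‖P y‖ ≤ Pinf)
    (hq : MemLp (fun y => (1 + ‖y‖ ^ 2) • h y) 2 (volume : Measure Space)) :
    ‖∫ y, P y • h y‖ ≤ (Pinf * (1 + t ^ 2) ^ γ * (eLpNorm (decayWeight γ) 2 volume).toReal
      + (t ^ 2)⁻¹ * (eLpNorm P 2 volume).toReal)
        * (eLpNorm (fun y => (1 + ‖y‖ ^ 2) • h y) 2 volume).toReal := by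
  obtain ⟨hI1, hb1⟩ := integral_norm_mul_norm_le (memLp_decayWeight hγ) hq
  obtain ⟨hI2, hb2⟩ := integral_norm_mul_norm_le (P.memLp 2 (volume : Measure Space)) hq
  have hPinf : 0 ≤ Pinf := (norm_nonneg _).trans (hP 0)
  have hpt : ∀ y, ‖P y • h y‖ ≤ Pinf * (1 + t ^ 2) ^ γ *
      (‖decayWeight γ y‖ * ‖(1 + ‖y‖ ^ 2) • h y‖)
      + (t ^ 2)⁻¹ * (‖P y‖ * ‖(1 + ‖y‖ ^ 2) • h y‖) := by
    intro y
    have hw : 0 ≤ decayWeight γ y := by unfold decayWeight; positivity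
    have h1 := norm_le_of_weighted hγ.le ht y (norm_nonneg (h y))
    rw [norm_smul, norm_smul, Real.norm_of_nonneg (by positivity : (0 : ℝ) ≤ 1 + ‖y‖ ^ 2),
      Real.norm_of_nonneg hw]
    calc ‖P y‖ * ‖h y‖ ≤ ‖P y‖ * ((1 + t ^ 2) ^ γ * (decayWeight γ y * ((1 + ‖y‖ ^ 2) * ‖h y‖))
          + (t ^ 2)⁻¹ * ((1 + ‖y‖ ^ 2) * ‖h y‖)) := by gcongr
      _ = ‖P y‖ * ((1 + t ^ 2) ^ γ * (decayWeight γ y * ((1 + ‖y‖ ^ 2) * ‖h y‖)))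
          + (t ^ 2)⁻¹ * (‖P y‖ * ((1 + ‖y‖ ^ 2) * ‖h y‖)) := by ring
      _ ≤ Pinf * ((1 + t ^ 2) ^ γ * (decayWeight γ y * ((1 + ‖y‖ ^ 2) * ‖h y‖)))
          + (t ^ 2)⁻¹ * (‖P y‖ * ((1 + ‖y‖ ^ 2) * ‖h y‖)) := by gcongr; exact hP y
      _ = _ := by ring
  refine (norm_integral_le_of_norm_le ((hI1.const_mul _).add (hI2.const_mul _))
    (Eventually.of_forall hpt)).trans ?_
  simp only [Pi.add_apply]
  rw [integral_add (hI1.const_mul _) (hI2.const_mul _), integral_const_mul, integral_const_mul]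
  calc _ ≤ Pinf * (1 + t ^ 2) ^ γ * ((eLpNorm (decayWeight γ) 2 volume).toReal *
        (eLpNorm (fun y => (1 + ‖y‖ ^ 2) • h y) 2 volume).toReal)
        + (t ^ 2)⁻¹ * ((eLpNorm P 2 volume).toReal *
        (eLpNorm (fun y => (1 + ‖y‖ ^ 2) • h y) 2 volume).toReal) := by gcongr
    _ = _ := by ring

/-- The constant of the damped dispersive estimate. -/
noncomputable def dampedConst (γ : ℝ) : ℝ :=
  876 * (eLpNorm (decayWeight γ) 2 (volume : Measure Space)).toReal
    + 6 * (eLpNorm (fun ξ : Space => freqBracket ξ ^ (-3 : ℝ)) 2 volume).toReal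

theorem dampedConst_nonneg (γ : ℝ) : 0 ≤ dampedConst γ := by unfold dampedConst; positivity

/-- Decay of the damped half wave: with `h` in the weighted space `L²(⟨y⟩⁴ dy)` it is `O(τ^(-2))`,
up to an arbitrarily small power of `τ` and powers of the damping. -/
theorem norm_integral_exp_smul_freqAmplitude_le {n τ γ ε Q : ℝ} {v : 𝓢'(Space, Spinor)}
    {G h : Lp Spinor 2 (volume : Measure Space)} (hG : bracketD n v = (G : 𝓢'(Space, Spinor)))
    (hh : propagator τ v = (h : 𝓢'(Space, Spinor))) (hγ : 0 < γ) (hτ : 1 ≤ |τ|)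
    (hε : 0 < ε) (hε1 : ε ≤ 1) (hετ : 1 ≤ ε * |τ|) (hQ0 : 0 ≤ Q)
    (hQ : eLpNorm (fun y => (1 + ‖y‖ ^ 2) • h y) 2 volume ≤ ENNReal.ofReal Q)
    (x : Space) {s : ℝ} (hεs : ε ≤ s) :
    ‖∫ ξ, Real.exp (-(s * freqBracket ξ)) • 𝐞 (inner ℝ ξ x) • freqAmplitude n G ξ‖
      ≤ (ε⁻¹ * (τ ^ 2)⁻¹ * (1 + τ ^ 2) ^ γ * dampedConst γ * Q) * s ^ (-2 : ℝ) := by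
  have hs : 0 < s := hε.trans_le hεs
  have ht : 0 < |τ| := by linarith
  simp_rw [smul_comm (Real.exp _) (𝐞 _)]
  rw [integral_exp_smul_freqAmplitude_eq hG hh x hs]
  have hm : AEStronglyMeasurable (fun y : Space => (1 + ‖y‖ ^ 2) • h y) volume :=
    (by fun_prop : Continuous fun y : Space => 1 + ‖y‖ ^ 2).aestronglyMeasurable.smul
      (Lp.aestronglyMeasurable h)
  have hmem : MemLp (fun y : Space => (1 + ‖y‖ ^ 2) • h y) 2 volume :=
    ⟨hm, hQ.trans_lt ENNReal.ofReal_lt_top⟩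
  have h1 := norm_integral_smul_le_of_weighted (P := 𝓕 (waveSchwartz x τ hs)) hγ ht
    (norm_fourier_waveSchwartz_le x hs hτ hε hε1 hετ hεs) hmem
  have h2 := eLpNorm_fourier_waveSchwartz_le x τ hs
  have h3 : (eLpNorm (fun y : Space => (1 + ‖y‖ ^ 2) • h y) 2 volume).toReal ≤ Q :=
    ENNReal.toReal_le_of_le_ofReal hQ0 hQ
  have h4 : s ^ (-3 : ℝ) ≤ ε⁻¹ * s ^ (-2 : ℝ) := by
    rw [show (-3 : ℝ) = -2 - 1 by norm_num, Real.rpow_sub_one hs.ne', div_eq_inv_mul]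
    gcongr
  have h5 : 1 ≤ (1 + |τ| ^ 2) ^ γ := Real.one_le_rpow (by nlinarith [sq_nonneg |τ|]) hγ.le
  set D := (eLpNorm (decayWeight γ) 2 (volume : Measure Space)).toReal with hD
  set R := (eLpNorm (fun ξ : Space => freqBracket ξ ^ (-3 : ℝ)) 2 volume).toReal with hR
  have hR0 : 0 ≤ R := ENNReal.toReal_nonneg
  have hD0 : 0 ≤ D := ENNReal.toReal_nonneg
  refine h1.trans ?_
  have h6 : (eLpNorm (𝓕 (waveSchwartz x τ hs) : 𝓢(Space, ℂ)) 2 volume).toReal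
      ≤ 6 * (ε⁻¹ * s ^ (-2 : ℝ)) * R * (1 + |τ| ^ 2) ^ γ := by
    refine h2.trans ?_
    calc 6 * s ^ (-3 : ℝ) * R ≤ 6 * (ε⁻¹ * s ^ (-2 : ℝ)) * R := by gcongr
      _ ≤ _ := le_mul_of_one_le_right (by positivity) h5
  calc _ ≤ (876 * (ε⁻¹ * s ^ (-2 : ℝ) * (|τ| ^ 2)⁻¹) * (1 + |τ| ^ 2) ^ γ * D
        + (|τ| ^ 2)⁻¹ * (6 * (ε⁻¹ * s ^ (-2 : ℝ)) * R * (1 + |τ| ^ 2) ^ γ)) * Q := by gcongr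
    _ = _ := by rw [dampedConst, sq_abs]; ring

/-! ### High frequencies and the profile -/

theorem aestronglyMeasurable_freqAmplitude (n : ℝ) (G : Lp Spinor 2 (volume : Measure Space)) :
    AEStronglyMeasurable (freqAmplitude n G) volume := by
  exact (Complex.measurable_ofReal.comp
    (continuous_freqBracket.measurable.pow_const _)).aestronglyMeasurable.smul
      (Lp.aestronglyMeasurable (𝓕 G))

theorem integral_freqBracket_pow_mul_norm_freqAmplitude_le {n : ℝ} {M : ℕ} (hMn : (M : ℝ) + 3 ≤ n)
    (G : Lp Spinor 2 (volume : Measure Space)) :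
    Integrable (fun ξ => freqBracket ξ ^ M * ‖freqAmplitude n G ξ‖) ∧
      ∫ ξ, freqBracket ξ ^ M * ‖freqAmplitude n G ξ‖
        ≤ (eLpNorm (fun ξ : Space => freqBracket ξ ^ (-3 : ℝ)) 2 volume).toReal * ‖G‖ := by
  obtain ⟨hI, hb⟩ := integral_norm_mul_norm_le memLp_freqBracket_rpow
    (Lp.memLp (𝓕 G : Lp Spinor 2 (volume : Measure Space)))
  rw [← Lp.norm_def, Lp.norm_fourier_eq] at hb
  have hpt : ∀ ξ, freqBracket ξ ^ M * ‖freqAmplitude n G ξ‖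
      ≤ ‖freqBracket ξ ^ (-3 : ℝ)‖ * ‖(𝓕 G : Lp Spinor 2 (volume : Measure Space)) ξ‖ := by
    intro ξ
    have hl := freqBracket_pos ξ
    rw [freqAmplitude, norm_smul, Complex.norm_real, Real.norm_of_nonneg (by positivity),
      Real.norm_of_nonneg (by positivity), ← mul_assoc, ← Real.rpow_natCast, ← Real.rpow_add hl]
    gcongr
    · exact one_le_freqBracket ξ
    · linarith
  have hint : Integrable (fun ξ => freqBracket ξ ^ M * ‖freqAmplitude n G ξ‖) := by
    refine hI.mono' ((continuous_freqBracket.pow M).aestronglyMeasurable.mul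
      (aestronglyMeasurable_freqAmplitude n G).norm) (Eventually.of_forall fun ξ => ?_)
    have hl := freqBracket_pos ξ
    rw [Real.norm_of_nonneg (by positivity)]
    exact hpt ξ
  exact ⟨hint, (integral_mono hint hI hpt).trans hb⟩

theorem toTemperedDistribution_injective {f g : Lp Spinor 2 (volume : Measure Space)}
    (h : (f : 𝓢'(Space, Spinor)) = (g : 𝓢'(Space, Spinor))) : f = g := by
  have hk := Lp.ker_toTemperedDistributionCLM_eq_bot (F := Spinor) (μ := (volume : Measure Space))
    (p := 2)
  exact LinearMap.ker_eq_bot.1 hk h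

/-- The profile is bounded in `L²` by the Sobolev norm of the half wave. -/
theorem norm_profile_le {n τ : ℝ} (hn : 0 ≤ n) {v : 𝓢'(Space, Spinor)}
    {G h : Lp Spinor 2 (volume : Measure Space)} (hG : bracketD n v = (G : 𝓢'(Space, Spinor)))
    (hh : propagator τ v = (h : 𝓢'(Space, Spinor))) : ‖h‖ ≤ ‖G‖ := by
  let m : Space → ℂ := (fun ξ : Space => ((freqBracket ξ ^ (-n) : ℝ) : ℂ)) *
    fun ξ : Space => Complex.exp (Complex.I * ((τ * freqBracket ξ : ℝ) : ℂ))
  have hm : m.HasTemperateGrowth :=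
    (hasTemperateGrowth_bracket_symbol (-n)).mul (hasTemperateGrowth_propagator_symbol τ)
  have hbound : ∀ ξ, ‖m ξ‖ ≤ 1 := by
    intro ξ
    have hl := freqBracket_pos ξ
    simp only [m, Pi.mul_apply]
    rw [norm_mul, mul_comm Complex.I, Complex.norm_exp_ofReal_mul_I, mul_one, Complex.norm_real,
      Real.norm_of_nonneg (by positivity)]
    exact Real.rpow_le_one_of_one_le_of_nonpos (one_le_freqBracket ξ) (by linarith)
  have hmem : MemLp m ∞ (volume : Measure Space) :=
    memLp_top_of_bound hm.1.continuous.aestronglyMeasurable 1 (Eventually.of_forall hbound)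
  have key : 𝓕 h = (hmem.toLp m • (𝓕 G : Lp Spinor 2 (volume : Measure Space)) :
      Lp Spinor 2 (volume : Measure Space)) := by
    apply toTemperedDistribution_injective
    rw [Lp.toTemperedDistribution_smul_eq hm hmem, ← Lp.fourier_toTemperedDistribution_eq,
      ← Lp.fourier_toTemperedDistribution_eq, ← hh, ← bracketD_neg_bracketD n v, hG, bracketD_eq,
      propagator_eq, fourierMultiplierCLM_fourierMultiplierCLM_apply
        (hasTemperateGrowth_bracket_symbol _) (hasTemperateGrowth_propagator_symbol _),
      fourierMultiplierCLM_apply, FourierTransform.fourier_fourierInv_eq]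
  rw [← Lp.norm_fourier_eq h, key, ← Lp.norm_fourier_eq G]
  refine (Lp.norm_smul_le _ _).trans ?_
  refine mul_le_of_le_one_left (norm_nonneg _) ?_
  rw [Lp.norm_toLp]
  refine ENNReal.toReal_le_of_le_ofReal zero_le_one ?_
  rw [eLpNorm_exponent_top]
  exact eLpNormEssSup_le_of_ae_bound (Eventually.of_forall hbound)

theorem eLpNorm_one_add_norm_sq_smul_le {h : Lp Spinor 2 (volume : Measure Space)} {A₀ A₂ : ℝ}
    (h0 : ‖h‖ ≤ A₀) (hA₀ : 0 ≤ A₀) (hA₂ : 0 ≤ A₂)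
    (h2 : eLpNorm (fun y => ‖y‖ ^ 2 • h y) 2 volume ≤ ENNReal.ofReal A₂) :
    eLpNorm (fun y => (1 + ‖y‖ ^ 2) • h y) 2 volume ≤ ENNReal.ofReal (A₀ + A₂) := by
  have e : (fun y => (1 + ‖y‖ ^ 2) • h y) = (h : Space → Spinor) + fun y => ‖y‖ ^ 2 • h y := by
    ext1 y; simp [add_smul]
  have hm : AEStronglyMeasurable (fun y : Space => ‖y‖ ^ 2 • h y) volume :=
    (by fun_prop : Continuous fun y : Space => ‖y‖ ^ 2).aestronglyMeasurable.smul
      (Lp.aestronglyMeasurable h)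
  rw [e, ENNReal.ofReal_add hA₀ hA₂]
  refine (eLpNorm_add_le (Lp.aestronglyMeasurable h) hm (by norm_num)).trans (add_le_add ?_ h2)
  rw [← Lp.enorm_def, ← ofReal_norm]
  exact ENNReal.ofReal_le_ofReal h0

theorem norm_integral_fourierChar_smul_le {n k : ℝ} {M : ℕ} (hkM : k ≤ M) (hMn : (M : ℝ) + 3 ≤ n)
    (G : Lp Spinor 2 (volume : Measure Space)) :
    Integrable (fun ξ => ((freqBracket ξ ^ k : ℝ) : ℂ) • freqAmplitude n G ξ) ∧
    ∀ x : Space, ‖∫ ξ, 𝐞 (inner ℝ ξ x) • ((freqBracket ξ ^ k : ℝ) : ℂ) • freqAmplitude n G ξ‖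
      ≤ (eLpNorm (fun ξ : Space => freqBracket ξ ^ (-3 : ℝ)) 2 volume).toReal * ‖G‖ := by
  obtain ⟨hI, hb⟩ := integral_freqBracket_pow_mul_norm_freqAmplitude_le hMn G
  have hpt : ∀ ξ, ‖((freqBracket ξ ^ k : ℝ) : ℂ) • freqAmplitude n G ξ‖
      ≤ freqBracket ξ ^ M * ‖freqAmplitude n G ξ‖ := by
    intro ξ
    have hl := freqBracket_pos ξ
    rw [norm_smul, Complex.norm_real, Real.norm_of_nonneg (by positivity), ← Real.rpow_natCast]
    gcongr
    exact one_le_freqBracket ξ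
  refine ⟨hI.mono' ?_ (Eventually.of_forall hpt), fun x => ?_⟩
  · exact AEStronglyMeasurable.smul (Complex.measurable_ofReal.comp
      (continuous_freqBracket.measurable.pow_const _)).aestronglyMeasurable
      (aestronglyMeasurable_freqAmplitude n G)
  · refine (norm_integral_le_of_norm_le hI (Eventually.of_forall fun ξ => ?_)).trans hb
    rw [Circle.norm_smul]
    exact hpt ξ

/-- The decay estimate before the frequency threshold `1 / ε` is chosen. -/
theorem bumpConst_mul_norm_le {n k τ γ ε Q : ℝ} {M : ℕ} {v : 𝓢'(Space, Spinor)}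
    {G h : Lp Spinor 2 (volume : Measure Space)} (hG : bracketD n v = (G : 𝓢'(Space, Spinor)))
    (hh : propagator τ v = (h : 𝓢'(Space, Spinor))) (hk : 0 ≤ k) (hkM : k + 1 ≤ M)
    (hMn : (M : ℝ) + 3 ≤ n) (hγ : 0 < γ) (hτ : 1 ≤ |τ|)
    (hε : 0 < ε) (hε1 : ε ≤ 1) (hετ : 1 ≤ ε * |τ|) (hQ0 : 0 ≤ Q)
    (hQ : eLpNorm (fun y => (1 + ‖y‖ ^ 2) • h y) 2 volume ≤ ENNReal.ofReal Q) (x : Space) :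
    bumpConst M k * ‖∫ ξ, 𝐞 (inner ℝ ξ x) • ((freqBracket ξ ^ k : ℝ) : ℂ) • freqAmplitude n G ξ‖
      ≤ ε ^ (M - k) * ((eLpNorm (fun ξ : Space => freqBracket ξ ^ (-3 : ℝ)) 2 volume).toReal * ‖G‖)
        + 2 ^ M * ((τ ^ 2)⁻¹ * (1 + τ ^ 2) ^ γ * dampedConst γ * Q) * ε ^ (-(k + 3)) := by
  obtain ⟨hI, hb⟩ := integral_freqBracket_pow_mul_norm_freqAmplitude_le hMn G
  have hch : Continuous fun ξ : Space => 𝐞 (inner ℝ ξ x) :=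
    continuous_fourierChar.comp (by fun_prop)
  have h := bumpConst_mul_norm_integral_le (μ := (volume : Measure Space)) (l := freqBracket)
    continuous_freqBracket.measurable one_le_freqBracket
    (g := fun ξ => 𝐞 (inner ℝ ξ x) • freqAmplitude n G ξ)
    (hch.aestronglyMeasurable.smul (aestronglyMeasurable_freqAmplitude n G)) (M := M)
    (by simpa only [Circle.norm_smul] using hI) hk hkM hε
    (B := ε⁻¹ * (τ ^ 2)⁻¹ * (1 + τ ^ 2) ^ γ * dampedConst γ * Q)
    (by have := dampedConst_nonneg γ; positivity)
    (fun s hs => norm_integral_exp_smul_freqAmplitude_le hG hh hγ hτ hε hε1 hετ hQ0 hQ x hs)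
  simp only [Circle.norm_smul] at h
  have e : ∫ ξ, 𝐞 (inner ℝ ξ x) • ((freqBracket ξ ^ k : ℝ) : ℂ) • freqAmplitude n G ξ
      = ∫ ξ, freqBracket ξ ^ k • 𝐞 (inner ℝ ξ x) • freqAmplitude n G ξ := by
    refine integral_congr_ae (Eventually.of_forall fun ξ => ?_)
    simp only
    rw [Complex.coe_smul, smul_comm]
  rw [e]
  refine h.trans ?_
  have e2 : ε ^ (-(k + 3)) = ε⁻¹ * ε ^ (-(k + 2)) := by
    rw [show -(k + 3) = -(k + 2) - 1 by ring, Real.rpow_sub_one hε.ne', div_eq_inv_mul]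
  rw [e2]
  refine add_le_add (by gcongr) (le_of_eq ?_)
  ring

theorem bracketPow_eq (s t : ℝ) : bracketPow s t = (1 + t ^ 2) ^ (s / 2) := by
  rw [bracketPow, Real.norm_eq_abs, sq_abs]

theorem rpow_le_bracketPow {t a : ℝ} (ht : 0 ≤ t) (ha : 0 ≤ a) : t ^ a ≤ bracketPow a t := by
  rw [bracketPow_eq]
  calc t ^ a = (t ^ 2) ^ (a / 2) := by
        rw [← Real.rpow_natCast, ← Real.rpow_mul ht]; congr 1; push_cast; ring
    _ ≤ _ := by gcongr; linarith

theorem bracketPow_add (a b t : ℝ) : bracketPow (a + b) t = bracketPow a t * bracketPow b t := by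
  rw [bracketPow_eq, bracketPow_eq, bracketPow_eq, ← Real.rpow_add (by positivity)]
  congr 1; ring

theorem bracketPow_mono {a b : ℝ} (t : ℝ) (hab : a ≤ b) : bracketPow a t ≤ bracketPow b t := by
  rw [bracketPow_eq, bracketPow_eq]
  exact Real.rpow_le_rpow_of_exponent_le (by nlinarith [sq_nonneg t]) (by linarith)

theorem bracketPow_zero (t : ℝ) : bracketPow 0 t = 1 := by rw [bracketPow_eq]; simp

theorem bracketPow_pos (a t : ℝ) : 0 < bracketPow a t := by rw [bracketPow_eq]; positivity

theorem inv_sq_le_bracketPow {t : ℝ} (ht : 1 ≤ t) : (t ^ 2)⁻¹ ≤ 2 * bracketPow (-2) t := by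
  rw [bracketPow_eq, show (-2 / 2 : ℝ) = -1 by norm_num, Real.rpow_neg_one, ← div_eq_mul_inv,
    le_div_iff₀ (by positivity), inv_mul_le_iff₀ (by positivity)]
  nlinarith

/-- The choice `ε = t^(-β/25)`: the high frequencies contribute at most `t^(-2)`, and the low ones
lose at most `t^β`. -/
theorem choice_of_threshold {n β δ k t R D A : ℝ} {M : ℕ} (hn : 450 < n) (hβ : 56 / (n - 2) ≤ β)
    (hδ : 0 < δ) (hk : k ≤ 20) (hM : n - 4 ≤ M) (ht : 1 ≤ t) (hR : 0 ≤ R) (hD : 0 ≤ D)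
    (hA : 0 ≤ A) :
    (t ^ (-(β / 25))) ^ (M - k) * (R * (2 * A))
      + 2 ^ M * ((t ^ 2)⁻¹ * (1 + t ^ 2) ^ (1 / (n - 2)) * D * (2 * A + 2 * A * bracketPow δ t))
        * (t ^ (-(β / 25))) ^ (-(k + 3))
      ≤ (4 * R + 8 * 2 ^ M * D) * A * bracketPow (-2 + β + δ) t := by
  have hn2 : 0 < n - 2 := by linarith
  have hβ0 : 0 < β := lt_of_lt_of_le (by positivity) hβ
  have ht0 : 0 < t := by linarith
  have hβn : 56 ≤ β * (n - 2) := (div_le_iff₀ hn2).1 hβ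
  have hinv := inv_sq_le_bracketPow ht
  have hexp1 : (t ^ (-(β / 25))) ^ ((M : ℝ) - k) ≤ 2 * bracketPow (-2 + β + δ) t := by
    rw [← Real.rpow_mul ht0.le]
    have h50 : 50 ≤ β * (M - k) := by
      have h1 : β * (n - 24) ≤ β * (M - k) :=
        mul_le_mul_of_nonneg_left (by linarith) hβ0.le
      have h2 : 50 * (n - 2) ≤ 56 * (n - 24) := by linarith
      have h3 : 56 * (n - 24) ≤ β * (n - 2) * (n - 24) := by gcongr; linarith
      have h4 : 50 * (n - 2) ≤ (β * (n - 24)) * (n - 2) := by linarith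
      exact (le_of_mul_le_mul_right h4 hn2).trans h1
    calc t ^ (-(β / 25) * ((M : ℝ) - k)) ≤ t ^ (-2 : ℝ) := by
          refine Real.rpow_le_rpow_of_exponent_le ht ?_
          nlinarith
      _ = (t ^ 2)⁻¹ := by rw [Real.rpow_neg ht0.le]; norm_cast
      _ ≤ 2 * bracketPow (-2) t := hinv
      _ ≤ _ := by gcongr; exact bracketPow_mono t (by linarith)
  have hexp2 : (t ^ (-(β / 25))) ^ (-(k + 3)) ≤ bracketPow (23 * β / 25) t := by
    rw [← Real.rpow_mul ht0.le]
    calc t ^ (-(β / 25) * -(k + 3)) ≤ t ^ (23 * β / 25) := by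
          refine Real.rpow_le_rpow_of_exponent_le ht ?_
          nlinarith
      _ ≤ _ := rpow_le_bracketPow ht0.le (by positivity)
  have hexp3 : (1 + t ^ 2) ^ (1 / (n - 2)) ≤ bracketPow (2 * β / 25) t := by
    rw [bracketPow_eq]
    refine Real.rpow_le_rpow_of_exponent_le (by nlinarith) ?_
    rw [div_le_iff₀ hn2]
    linarith
  have hδ1 : 1 ≤ bracketPow δ t := by
    rw [← bracketPow_zero t]; exact bracketPow_mono t hδ.le
  have hprod : bracketPow (-2) t * bracketPow (2 * β / 25) t * bracketPow δ t *
      bracketPow (23 * β / 25) t = bracketPow (-2 + β + δ) t := by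
    rw [← bracketPow_add, ← bracketPow_add, ← bracketPow_add]; congr 1; ring
  have hAδ : 2 * A + 2 * A * bracketPow δ t ≤ 4 * A * bracketPow δ t := by nlinarith
  have hp1 := bracketPow_pos (-2) t
  have hp2 := bracketPow_pos (2 * β / 25) t
  have hp3 := bracketPow_pos δ t
  have hp4 := bracketPow_pos (23 * β / 25) t
  calc _ ≤ 2 * bracketPow (-2 + β + δ) t * (R * (2 * A))
      + 2 ^ M * ((2 * bracketPow (-2) t) * bracketPow (2 * β / 25) t * D *
        (4 * A * bracketPow δ t)) * bracketPow (23 * β / 25) t := by gcongr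
    _ = 4 * R * A * bracketPow (-2 + β + δ) t + 8 * 2 ^ M * D * A *
        (bracketPow (-2) t * bracketPow (2 * β / 25) t * bracketPow δ t *
          bracketPow (23 * β / 25) t) := by ring
    _ = _ := by rw [hprod]; ring

theorem exists_Lp_of_sobolevNorm_lt {n A : ℝ} {v : 𝓢'(Space, Spinor)} (hA : 0 ≤ A)
    (h : sobolevNorm n v < ENNReal.ofReal A) :
    ∃ G : Lp Spinor 2 (volume : Measure Space), bracketD n v = (G : 𝓢'(Space, Spinor)) ∧
      ‖G‖ ≤ A := by
  unfold sobolevNorm distLpNorm at h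
  obtain ⟨G, h⟩ := iInf_lt_iff.1 h
  obtain ⟨hG, h⟩ := iInf_lt_iff.1 h
  refine ⟨G, hG, ?_⟩
  rw [Lp.norm_def]
  exact ENNReal.toReal_le_of_le_ofReal hA h.le

theorem exists_Lp_of_weightedL2Norm_lt {j : ℕ} {b : ℝ≥0∞} {u : 𝓢'(Space, Spinor)}
    (h : weightedL2Norm j u < b) :
    ∃ f : Lp Spinor 2 (volume : Measure Space), u = (f : 𝓢'(Space, Spinor)) ∧
      eLpNorm (fun y => ‖y‖ ^ j • f y) 2 volume ≤ b := by
  unfold weightedL2Norm at h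
  obtain ⟨f, h⟩ := iInf_lt_iff.1 h
  obtain ⟨hf, h⟩ := iInf_lt_iff.1 h
  exact ⟨f, hf, h.le⟩

theorem halfWaveNorm_le_spinorNorm (n δ T : ℝ) (α : Fin 4 → Matrix (Fin 4) (Fin 4) ℂ)
    (γ₀ : Matrix (Fin 4) (Fin 4) ℂ) (ψ : ℝ → 𝓢'(Space, Spinor)) (θ : ℤˣ) :
    halfWaveNorm n δ T α γ₀ ψ θ ≤ spinorNorm n δ T α γ₀ ψ := by
  unfold spinorNorm
  rcases Int.units_eq_one_or θ with rfl | rfl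
  · exact le_self_add
  · exact le_add_self

/-- The functions behind the a priori norm at one time: `G = ⟨D⟩^n ψ_θ(t)` and the profile `h`. -/
theorem exists_Lp_of_spinorNorm_le {n δ T A : ℝ} {α : Fin 4 → Matrix (Fin 4) (Fin 4) ℂ}
    {γ₀ : Matrix (Fin 4) (Fin 4) ℂ} {ψ : ℝ → 𝓢'(Space, Spinor)} (hA : 0 < A)
    (h : spinorNorm n δ T α γ₀ ψ ≤ ENNReal.ofReal A) (θ : ℤˣ) {t : ℝ} (ht : t ∈ Icc 0 T) :
    ∃ G f : Lp Spinor 2 (volume : Measure Space),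
      bracketD n (halfWave α γ₀ ψ θ t) = (G : 𝓢'(Space, Spinor)) ∧ ‖G‖ ≤ 2 * A ∧
      propagator (((θ : ℤ) : ℝ) * t) (halfWave α γ₀ ψ θ t) = (f : 𝓢'(Space, Spinor)) ∧
      eLpNorm (fun y => ‖y‖ ^ 2 • f y) 2 volume
        ≤ ENNReal.ofReal (2 * A * bracketPow δ t) := by
  have h1 : sobolevNorm n (halfWave α γ₀ ψ θ t) + weightedL2Norm 1 (profile α γ₀ ψ θ t)
      + ENNReal.ofReal (bracketPow (-δ) t) * weightedL2Norm 2 (profile α γ₀ ψ θ t)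
      ≤ ENNReal.ofReal A :=
    (le_iSup₂ (f := fun t (_ : t ∈ Icc (0 : ℝ) T) => sobolevNorm n (halfWave α γ₀ ψ θ t)
      + weightedL2Norm 1 (profile α γ₀ ψ θ t)
      + ENNReal.ofReal (bracketPow (-δ) t) * weightedL2Norm 2 (profile α γ₀ ψ θ t)) t ht).trans
      ((halfWaveNorm_le_spinorNorm n δ T α γ₀ ψ θ).trans h)
  have hlt : ENNReal.ofReal A < ENNReal.ofReal (2 * A) :=
    (ENNReal.ofReal_lt_ofReal_iff (by linarith)).2 (by linarith)
  have hS : sobolevNorm n (halfWave α γ₀ ψ θ t) < ENNReal.ofReal (2 * A) :=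
    ((le_self_add.trans le_self_add).trans h1).trans_lt hlt
  have hW : weightedL2Norm 2 (profile α γ₀ ψ θ t) < ENNReal.ofReal (2 * A * bracketPow δ t) := by
    have h2 := (le_add_self.trans h1).trans_lt hlt
    have hone : ENNReal.ofReal (bracketPow δ t) * ENNReal.ofReal (bracketPow (-δ) t) = 1 := by
      rw [← ENNReal.ofReal_mul (bracketPow_pos δ t).le, ← bracketPow_add, add_neg_cancel,
        bracketPow_zero, ENNReal.ofReal_one]
    have h3 : ENNReal.ofReal (bracketPow δ t) * (ENNReal.ofReal (bracketPow (-δ) t) *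
        weightedL2Norm 2 (profile α γ₀ ψ θ t))
        < ENNReal.ofReal (bracketPow δ t) * ENNReal.ofReal (2 * A) :=
      ENNReal.mul_lt_mul_right
        (ENNReal.ofReal_pos.2 (bracketPow_pos δ t)).ne' ENNReal.ofReal_ne_top h2
    rwa [← mul_assoc, hone, one_mul, ← ENNReal.ofReal_mul (bracketPow_pos δ t).le,
      mul_comm (bracketPow δ t)] at h3
  obtain ⟨G, hG, hGn⟩ := exists_Lp_of_sobolevNorm_lt (by linarith) hS
  obtain ⟨f, hf, hfn⟩ := exists_Lp_of_weightedL2Norm_lt hW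
  exact ⟨G, f, hG, hGn, hf, hfn⟩

end MaxwellDirac

open MaxwellDirac in
theorem proposition2p3 (n : ℝ) (hn : 2 < n) (K : ℝ) (hK : 0 < K) :
    ∃ C : ℝ, 0 < C ∧
      ∀ (β δ : ℝ), 0 < β → β < δ → 56 / (n - 2) ≤ β → β + δ ≤ 1 / 4 →
      ∀ (α : Fin 4 → Matrix (Fin 4) (Fin 4) ℂ) (γ₀ : Matrix (Fin 4) (Fin 4) ℂ),
        IsDiracFamily α γ₀ →
      ∀ (ε₁ T : ℝ), 0 < ε₁ → 0 < T →
      ∀ ψ : ℝ → 𝓢'(Space, Spinor),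
        spinorNorm n δ T α γ₀ ψ ≤ ENNReal.ofReal (K * ε₁) →
      ∀ (θ : ℤˣ) (k : ℝ), 0 ≤ k → k ≤ 20 → ∀ t ∈ Set.Icc (0 : ℝ) T,
        sobolevInftyNorm k (halfWave α γ₀ ψ θ t)
          ≤ ENNReal.ofReal (C * bracketPow (-2 + β + δ) t * ε₁) := by
  have hn2 : 0 < n - 2 := by linarith
  set M : ℕ := ⌊n⌋₊ - 3 with hMdef
  obtain ⟨c, hc, hcle⟩ := exists_pos_le_bumpConst M 20
  set R := (eLpNorm (fun ξ : Space => freqBracket ξ ^ (-3 : ℝ)) 2 volume).toReal with hR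
  have hR0 : 0 ≤ R := ENNReal.toReal_nonneg
  set D := dampedConst (1 / (n - 2)) with hD
  have hD0 : 0 ≤ D := dampedConst_nonneg _
  refine ⟨4 * R * K + c⁻¹ * ((4 * R + 8 * 2 ^ M * D) * K) + 1, by positivity, ?_⟩
  intro β δ hβ hβδ hβn hsum α γ₀ _ ε₁ T hε₁ _ ψ hψ θ k hk0 hk t ht
  -- the constraints on `β` and `δ` leave only large `n`
  have hn450 : 450 < n := by
    have h1 : 56 / (n - 2) < 1 / 8 := by linarith
    rw [div_lt_iff₀ hn2] at h1
    linarith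
  have hδ : 0 < δ := hβ.trans hβδ
  have hfloor : (M : ℝ) = ⌊n⌋₊ - 3 := by
    rw [hMdef, Nat.cast_sub]
    · norm_num
    · exact Nat.le_floor (by push_cast; linarith)
  have hMle : (M : ℝ) + 3 ≤ n := by
    rw [hfloor]; linarith [Nat.floor_le (show 0 ≤ n by linarith)]
  have hMge : n - 4 ≤ M := by
    rw [hfloor]; linarith [Nat.lt_floor_add_one n]
  have hA : 0 < K * ε₁ := by positivity
  obtain ⟨G, f, hG, hGn, hf, hfn⟩ := exists_Lp_of_spinorNorm_le hA hψ θ ht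
  obtain ⟨hint, hsup⟩ := norm_integral_fourierChar_smul_le (k := k) (by linarith) hMle G
  refine distLpNorm_top_le hint (fun φ => bracketD_apply_eq_integral hG k φ) fun x => ?_
  have hp := bracketPow_pos (-2 + β + δ) t
  rcases le_or_gt 1 t with ht1 | ht1
  · have hθt : |((θ : ℤ) : ℝ) * t| = t := by
      rcases Int.units_eq_one_or θ with rfl | rfl <;> simp [abs_of_pos (one_pos.trans_le ht1)]
    have hθt2 : (((θ : ℤ) : ℝ) * t) ^ 2 = t ^ 2 := by rw [← sq_abs, hθt]
    have ht0 : 0 < t := by linarith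
    have hQ := eLpNorm_one_add_norm_sq_smul_le
      ((norm_profile_le (by linarith) hG hf).trans hGn) (by positivity)
      (mul_nonneg (by positivity) (bracketPow_pos δ t).le) hfn
    have key := bumpConst_mul_norm_le (k := k) (γ := 1 / (n - 2)) (ε := t ^ (-(β / 25))) hG hf hk0
      (by linarith) hMle (by positivity) (by rw [hθt]; exact ht1) (by positivity)
      (Real.rpow_le_one_of_one_le_of_nonpos ht1 (by linarith))
      (by
        rw [hθt, ← Real.rpow_add_one ht0.ne']
        exact Real.one_le_rpow ht1 (by linarith))
      (add_nonneg (by positivity) (mul_nonneg (by positivity) (bracketPow_pos δ t).le)) hQ x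
    rw [hθt2] at key
    set N := ‖∫ ξ, Real.fourierChar (inner ℝ ξ x) • ((freqBracket ξ ^ k : ℝ) : ℂ) •
      freqAmplitude n G ξ‖ with hN
    have hN0 : 0 ≤ N := norm_nonneg _
    have key2 : c * N ≤ (4 * R + 8 * 2 ^ M * D) * (K * ε₁) * bracketPow (-2 + β + δ) t := by
      refine le_trans ?_ (choice_of_threshold (R := R) (D := D) (A := K * ε₁) hn450 hβn hδ hk hMge
        ht1 hR0 hD0 hA.le)
      refine (mul_le_mul_of_nonneg_right (hcle k hk (by linarith)) hN0).trans (key.trans ?_)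
      gcongr
    have key3 : N ≤ c⁻¹ * ((4 * R + 8 * 2 ^ M * D) * K) * bracketPow (-2 + β + δ) t * ε₁ := by
      rw [← mul_le_mul_iff_right₀ hc]
      refine key2.trans (le_of_eq ?_)
      field_simp
    refine key3.trans ?_
    gcongr
    have : 0 ≤ 4 * R * K := by positivity
    linarith
  · have hhalf : 1 ≤ 2 * bracketPow (-2 + β + δ) t := by
      have h1 : bracketPow (-2) t ≤ bracketPow (-2 + β + δ) t := bracketPow_mono t (by linarith)
      have h2 : 1 ≤ 2 * bracketPow (-2) t := by
        rw [bracketPow_eq, show (-2 / 2 : ℝ) = -1 by norm_num, Real.rpow_neg_one,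
          ← div_eq_mul_inv, one_le_div (by positivity)]
        nlinarith [ht.1]
      linarith
    calc _ ≤ R * ‖G‖ := hsup x
      _ ≤ R * (2 * (K * ε₁)) := by gcongr
      _ ≤ R * (2 * (K * ε₁)) * (2 * bracketPow (-2 + β + δ) t) :=
        le_mul_of_one_le_right (by positivity) hhalf
      _ = (4 * R * K) * bracketPow (-2 + β + δ) t * ε₁ := by ring
      _ ≤ _ := by
        gcongr
        have : 0 ≤ c⁻¹ * ((4 * R + 8 * 2 ^ M * D) * K) := by positivity
        linarith
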